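/- Let $p$ be an odd prime, $\zeta_p$ a primitive $p$-th root of unity, $K_p=\mathbb{Q}(\zeta_p)$, $G_p=\mathrm{Gal}(K_p/\mathbb{Q})$, and let $K_p^+$ be the maximal totally real subfield of $K_p$. Let $v$ be a primitive root modulo $p$; for every $n\in\mathbb{Z}$ write $v^n$ for the integer in $\{1,\dots,p-1\}$ congruent to the $n$-th power of $v$ modulo $p$ (in particular $v=v^1\in\{1,\dots,p-1\}$), and let $\sigma\in G_p$ be the automorphism with $\sigma(\zeta_p)=\zeta_p^{v}$. Put $$\delta_i=\frac{v^{-(i-1)}-v^{-i}\cdot v}{p}\in\mathbb{Z}\quad(1\le i\le p-2),\qquad Q(X)=\sum_{i=1}^{p-2}\delta_i X^i\in\mathbb{Z}[X].$$ Let $C_p$ be the elementary $p$-class group of $K_p$, that is, the group of ideal classes $c$ of $K_p$ with $c^p=1$, regarded as an $\mathbb{F}_p[G_p]$-module, and let $r$ be its rank, so that $|C_p|=p^r$. Assume that $p$ does not divide the class number $h(K_p^+)$. Then $C_p$ is a direct sum $\Gamma_1\oplus\dots\oplus\Gamma_r$ of subgroups $\Gamma_k$ of order $p$, each annihilated by $\sigma-\mu_k$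 for some $\mu_k\in\mathbb{F}_p^*$ (that is, $\sigma(c)=c^{\mu_k}$ for all $c\in\Gamma_k$). Moreover, for every such decomposition there are integers $m_1,\dots,m_r$ with $1\le m_k\le\frac{p-3}{2}$ and $\mu_k\equiv v^{2m_k+1}\pmod p$ such that, for $k=1,\dots,r$, $$Q(v^{2m_k+1})\equiv\sum_{i=1}^{p-2} v^{(2m_k+1)i}\cdot\frac{v^{-(i-1)}-v^{-i}\cdot v}{p}\equiv 0\pmod p,$$ and such that $\prod_{k=1}^r(\sigma-v^{2m_k+1})$ divides $Q(\sigma)$ in $\mathbb{F}_p[G_p]$. -/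

import Mathlib

open NumberField

namespace PClassGroup

/-- The integer written `v ^ n mod p` : for a unit `v` modulo `p` and `n : ℤ`, the representative
of `v ^ n` in `{1, …, p - 1}`. -/
def res {p : ℕ} (v : (ZMod p)ˣ) (n : ℤ) : ℤ :=
  (((v ^ n : (ZMod p)ˣ) : ZMod p).val : ℤ)

theorem cast_res {p : ℕ} [NeZero p] (v : (ZMod p)ˣ) (n : ℤ) :
    ((res v n : ℤ) : ZMod p) = ((v ^ n : (ZMod p)ˣ) : ZMod p) := by
  simp [res]

/-- The numerator in the definition of `delta` is divisible by `p`, so that the integer division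
there is exact. -/
theorem dvd_delta_num {p : ℕ} [NeZero p] (v : (ZMod p)ˣ) (i : ℤ) :
    (p : ℤ) ∣ res v (-(i - 1)) - res v (-i) * res v 1 := by
  rw [← ZMod.intCast_zmod_eq_zero_iff_dvd]
  push_cast
  rw [cast_res, cast_res, cast_res, ← Units.val_mul, ← zpow_add]
  rw [show -i + 1 = -(i - 1) by ring, sub_self]

/-- `δ_i = (v^{-(i-1)} - v^{-i} v) / p`, all powers of `v` being reduced to `{1, …, p - 1}`. -/
def delta {p : ℕ} (v : (ZMod p)ˣ) (i : ℤ) : ℤ :=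
  (res v (-(i - 1)) - res v (-i) * res v 1) / (p : ℤ)

theorem mul_delta {p : ℕ} [NeZero p] (v : (ZMod p)ˣ) (i : ℤ) :
    (p : ℤ) * delta v i = res v (-(i - 1)) - res v (-i) * res v 1 :=
  Int.mul_ediv_cancel' (dvd_delta_num v i)

/-- The integer polynomial `Q(X) = ∑_{i=1}^{p-2} δ_i X^i`. -/
noncomputable def Q {p : ℕ} (v : (ZMod p)ˣ) : Polynomial ℤ :=
  ∑ i ∈ Finset.Icc 1 (p - 2), Polynomial.C (delta v (i : ℤ)) * Polynomial.X ^ i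

/-- The action of an automorphism `σ` of `K` on the ideal class group of `𝓞 K`. -/
noncomputable def classAct {K : Type*} [Field K] [NumberField K] (σ : K ≃ₐ[ℚ] K) :
    ClassGroup (𝓞 K) ≃* ClassGroup (𝓞 K) :=
  ClassGroup.mulEquiv (RingOfIntegers.mapRingEquiv (σ : K ≃+* K))

/-- The (elementary) `p`-class group of `K`: the group of ideal classes `c` with `c ^ p = 1`,
i.e. the largest `𝔽_p`-vector space contained in the class group. -/
noncomputable def pClassGroup (p : ℕ) (K : Type*) [Field K] [NumberField K] :
    Subgroup (ClassGroup (𝓞 K)) :=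
  (powMonoidHom p : ClassGroup (𝓞 K) →* ClassGroup (𝓞 K)).ker

/-- The subgroups `Γ_1, …, Γ_r` have order `p`, the group `Γ_k` is annihilated by `σ - μ_k`
(that is, `σ(c) = c ^ μ_k` for `c ∈ Γ_k`), and the `p`-class group of `K` is their
(internal) direct sum. In particular `r` is the rank of the `p`-class group. -/
structure IsDecomposition (p : ℕ) {K : Type*} [Field K] [NumberField K] (σ : K ≃ₐ[ℚ] K)
    {r : ℕ} (Γ : Fin r → Subgroup (ClassGroup (𝓞 K))) (μ : Fin r → (ZMod p)ˣ) : Prop where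
  card_eq : ∀ k, Nat.card (Γ k) = p
  annihilated : ∀ k, ∀ c ∈ Γ k, classAct σ c = c ^ ((μ k : ZMod p).val)
  indep : iSupIndep Γ
  iSup_eq : ⨆ k, Γ k = pClassGroup p K

end PClassGroup

/-! Write h⁺ for the class number of the maximal real subfield. Since `σ ^ (p - 1) = 1` and X^(p-1)
- 1 splits over 𝔽_p with simple roots, `σ` acts diagonalizably on the p-torsion of the class group
(`MulEquiv.exists_diagonalization`). This gives the decomposition into eigenlines and uses nothing
about h⁺.

The eigenvalues are constrained by Stickelberger's theorem
(`PClassGroup.prod_classAct_pow_mul_div_eq_one`): for 1 ≤ b < p the element ∑ ⌊b a / p⌋ σ_a⁻¹ kills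
every class. On an eigenvector of order p with eigenvalue μ this becomes ∑ μ^i ⌊b v^{-i} / p⌋ = 0 in
𝔽_p. Since δ_i = -⌊v v^{-i} / p⌋, the case b = v says Q(μ) = 0. The case b = p - 1 fails at μ = v,
which excludes that eigenvalue. An even power of v is excluded because p ∤ h⁺ makes complex
conjugation act as -1 on p-torsion.

Stickelberger's theorem rests on two inputs. The primes with trivial decomposition group generate
the class group, by an elementary choice of element with no density theorem. For such a prime P, the
prime factors of a Jacobi sum are read off from its reduction modulo P and its conjugates.

The final divisibility holds because 𝔽_p[G_p] is 𝔽_p[X]/(X^(p-1) - 1), a product of copies of 𝔽_p,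
where only vanishing at points matters. -/

section

open scoped Pointwise nonZeroDivisors

/-! ### Galois action on ideal classes -/

section ClassGroupAction

variable {R S : Type*} [CommRing R] [IsDedekindDomain R] [CommRing S] [IsDedekindDomain S]

theorem FractionalIdeal.ringEquivOfRingEquiv_coeIdeal (K L : Type*) [Field K] [Field L]
    [Algebra R K] [Algebra S L] [IsFractionRing R K] [IsFractionRing S L] (f : R ≃+* S)
    (I : Ideal R) :
    FractionalIdeal.ringEquivOfRingEquiv K L f (I : FractionalIdeal R⁰ K) =
      ((I.map (f : R →+* S) : Ideal S) : FractionalIdeal S⁰ L) := by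
  ext x
  rw [FractionalIdeal.ringEquivOfRingEquiv_apply]
  simp only [FractionalIdeal.mem_coeIdeal]
  change x ∈ Submodule.map _ _ ↔ _
  simp only [Submodule.mem_map]
  constructor
  · rintro ⟨_, ⟨y, hy, rfl⟩, rfl⟩
    exact ⟨f y, Ideal.mem_map_of_mem (f : R →+* S) hy,
      (IsFractionRing.ringEquivOfRingEquiv_algebraMap f y).symm⟩
  · rintro ⟨y, hy, rfl⟩
    obtain ⟨z, hz, rfl⟩ := (Ideal.mem_map_of_equiv f y).1 hy
    exact ⟨algebraMap R K z, ⟨z, hz, rfl⟩, IsFractionRing.ringEquivOfRingEquiv_algebraMap f z⟩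

theorem ClassGroup.mulEquiv_mk0 (f : R ≃+* S) (I : (Ideal R)⁰) (J : (Ideal S)⁰)
    (h : (J : Ideal S) = (I : Ideal R).map (f : R →+* S)) :
    ClassGroup.mulEquiv f (ClassGroup.mk0 I) = ClassGroup.mk0 J := by
  simp only [ClassGroup.mulEquiv, MulEquiv.trans_apply, ClassGroup.equiv_mk0]
  rw [MulEquiv.symm_apply_eq, ClassGroup.equiv_mk0]
  refine congrArg (QuotientGroup.mk' _) ?_
  ext1
  simp [FractionalIdeal.ringEquivOfRingEquiv_coeIdeal, h]

end ClassGroupAction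

theorem Ideal.smul_ne_bot {M R : Type*} [Group M] [CommRing R] [MulSemiringAction M R] (g : M)
    {I : Ideal R} (hI : I ≠ ⊥) : g • I ≠ ⊥ := by
  intro h
  apply hI
  rw [← inv_smul_smul g I, h, Ideal.smul_bot]

section NumberField

variable {K : Type*} [Field K] [NumberField K]

theorem PClassGroup.classAct_mk0 (τ : K ≃ₐ[ℚ] K) {I : Ideal (𝓞 K)} (hI : I ≠ ⊥) :
    PClassGroup.classAct τ (ClassGroup.mk0 ⟨I, mem_nonZeroDivisors_of_ne_zero hI⟩) =
      ClassGroup.mk0 ⟨τ • I, mem_nonZeroDivisors_of_ne_zero (Ideal.smul_ne_bot τ hI)⟩ := by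
  refine ClassGroup.mulEquiv_mk0 _ _ _ ?_
  change Ideal.map _ I = Ideal.map _ I
  congr 1

theorem ClassGroup.exists_mk0_eq {R : Type*} [CommRing R] [IsDedekindDomain R]
    (c : ClassGroup R) :
    ∃ (I : Ideal R) (hI : I ≠ ⊥), ClassGroup.mk0 ⟨I, mem_nonZeroDivisors_of_ne_zero hI⟩ = c := by
  obtain ⟨⟨I, hI⟩, rfl⟩ := ClassGroup.mk0_surjective c
  exact ⟨I, nonZeroDivisors.ne_zero hI, rfl⟩

theorem PClassGroup.classAct_mul (τ τ' : K ≃ₐ[ℚ] K) (c : ClassGroup (𝓞 K)) :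
    PClassGroup.classAct (τ * τ') c = PClassGroup.classAct τ (PClassGroup.classAct τ' c) := by
  obtain ⟨I, hI, rfl⟩ := ClassGroup.exists_mk0_eq c
  rw [classAct_mk0 _ hI, classAct_mk0 _ hI, classAct_mk0 τ (Ideal.smul_ne_bot τ' hI)]
  simp only [mul_smul]

theorem PClassGroup.classAct_one (c : ClassGroup (𝓞 K)) :
    PClassGroup.classAct (1 : K ≃ₐ[ℚ] K) c = c := by
  obtain ⟨I, hI, rfl⟩ := ClassGroup.exists_mk0_eq c
  rw [classAct_mk0 _ hI]
  simp only [one_smul]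

theorem PClassGroup.classAct_pow (τ : K ≃ₐ[ℚ] K) (n : ℕ) (c : ClassGroup (𝓞 K)) :
    PClassGroup.classAct (τ ^ n) c = (PClassGroup.classAct τ)^[n] c := by
  induction n with
  | zero => simp [classAct_one]
  | succ n ih => rw [pow_succ', classAct_mul, ih, Function.iterate_succ_apply']

end NumberField

/-! ### The relative norm as a product of conjugates -/

section RelNorm

open Ideal

variable {R S G : Type*} [CommRing R] [IsDedekindDomain R] [CommRing S] [IsDedekindDomain S]
  [Algebra R S] [Module.Finite R S] [Module.IsTorsionFree R S] [PerfectField (FractionRing R)]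
  [Group G] [Fintype G] [MulSemiringAction G S] [IsGaloisGroup G R S]

/-- With p below P, the norm is p^f and p extends to the product of the Q^e over primes Q above p.
Each Q is hit by as many group elements as the stabilizer has, namely e f. -/
theorem Ideal.map_relNorm_eq_prod_smul_of_isPrime
    (P : Ideal S) [P.IsPrime] (hP : P ≠ ⊥) [PerfectField (P.under R).ResidueField] :
    (relNorm R P).map (algebraMap R S) = ∏ g : G, g • P := by
  classical
  have hPm : P.IsMaximal := Ring.DimensionLEOne.maximalOfPrime hP inferInstance
  have hpm : (P.under R).IsMaximal := isMaximal_comap_of_isIntegral_of_isMaximal P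
  have hp0 : P.under R ≠ ⊥ := mt Ideal.eq_bot_of_comap_eq_bot hP
  rw [relNorm_eq_pow_of_isMaximal P (P.under R), Ideal.map_pow,
    map_algebraMap_eq_finsetProd_pow hp0, ← Finset.prod_pow]
  have hmem : ∀ g : G, g • P ∈ (primesOver (P.under R) S).toFinset := by
    intro g
    rw [Set.mem_toFinset, ← Algebra.IsInvariant.orbit_eq_primesOver R S G (P.under R) P]
    exact MulAction.mem_orbit P g
  rw [← Finset.prod_fiberwise_of_maps_to (fun g _ => hmem g)]
  refine Finset.prod_congr rfl fun Q hQ => ?_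
  rw [Set.mem_toFinset] at hQ
  have : Q.IsPrime := hQ.1
  have : Q.LiesOver (P.under R) := hQ.2
  obtain ⟨g, rfl⟩ : ∃ g : G, g • P = Q := by
    rw [← Algebra.IsInvariant.orbit_eq_primesOver R S G (P.under R) P] at hQ
    exact hQ
  have hc : ∀ h ∈ Finset.univ.filter (fun h : G => h • P = g • P), h • P = g • P := by
    intro h hh
    exact (Finset.mem_filter.1 hh).2
  rw [Finset.prod_congr rfl hc, Finset.prod_const, ← pow_mul]
  congr 1
  have h1 : (Finset.univ.filter (fun h : G => h • P = g • P)).card =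
      Nat.card (MulAction.stabilizer G P) := by
    rw [Nat.card_eq_fintype_card, Fintype.card_subtype]
    refine Finset.card_bij' (fun h _ => g⁻¹ * h) (fun h _ => g * h) ?_ ?_ ?_ ?_
    · intro h hh
      simp only [Finset.mem_filter, Finset.mem_univ, true_and, MulAction.mem_stabilizer_iff] at hh ⊢
      rw [mul_smul, hh, inv_smul_smul]
    · intro h hh
      simp only [Finset.mem_filter, Finset.mem_univ, true_and, MulAction.mem_stabilizer_iff] at hh ⊢
      rw [mul_smul, hh]
    · simp
    · simp
  rw [h1, card_stabilizer_eq (P.under R) P, ← ramificationIdxIn_eq_ramificationIdx (P.under R) _ G,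
    ← inertiaDegIn_eq_inertiaDeg (P.under R) P G]

theorem Ideal.map_relNorm_eq_prod_smul
    (hR : ∀ p : Ideal R, p ≠ ⊥ → ∀ _ : p.IsPrime, PerfectField p.ResidueField) (I : Ideal S) :
    (relNorm R I).map (algebraMap R S) = ∏ g : G, g • I := by
  by_cases hI : I = ⊥
  · subst hI
    rw [relNorm_bot, Ideal.map_bot]
    simp only [Ideal.smul_bot]
    rw [Finset.prod_const, ← Ideal.zero_eq_bot, zero_pow]
    exact Finset.card_ne_zero.2 Finset.univ_nonempty
  induction I using UniqueFactorizationMonoid.induction_on_prime with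
  | h₁ => exact absurd rfl hI
  | h₂ I h =>
    rw [Ideal.isUnit_iff] at h
    subst h
    rw [relNorm_top, Ideal.map_top, ← Ideal.one_eq_top]
    simp only [smul_one, Finset.prod_const_one]
  | h₃ I P hI0 hP ih =>
    have : P.IsPrime := Ideal.isPrime_of_prime hP
    have := hR (P.under R) (mt Ideal.eq_bot_of_comap_eq_bot hP.ne_zero) inferInstance
    rw [map_mul, Ideal.map_mul, ih hI0, map_relNorm_eq_prod_smul_of_isPrime (G := G) P hP.ne_zero,
      ← Finset.prod_mul_distrib]
    simp only [smul_mul']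

end RelNorm

/-! ### Generating the class group by primes with trivial stabilizer -/

theorem Nat.exists_coprime_dvd_mul_pow (N : ℕ) {M : ℕ} (hM : M ≠ 0) :
    ∃ m e : ℕ, m.Coprime N ∧ M ∣ m * N ^ e := by
  induction M using Nat.strong_induction_on with
  | _ M ih =>
    by_cases h : M.Coprime N
    · exact ⟨M, 0, h, by simp⟩
    · obtain ⟨k, hk⟩ := Nat.gcd_dvd_left M N
      have hk0 : k ≠ 0 := by rintro rfl; simp at hk; exact hM hk
      have hg0 : Nat.gcd M N ≠ 0 := fun h0 => hM (Nat.eq_zero_of_gcd_eq_zero_left h0)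
      have hlt : k < M := by
        have h2 : 2 ≤ Nat.gcd M N := by
          have : Nat.gcd M N ≠ 1 := h
          omega
        calc k < 2 * k := by omega
          _ ≤ Nat.gcd M N * k := Nat.mul_le_mul_right k h2
          _ = M := hk.symm
      obtain ⟨m, e, hm, hd⟩ := ih k hlt hk0
      refine ⟨m, e + 1, hm, ?_⟩
      rw [hk, pow_succ, ← mul_assoc, mul_comm]
      exact mul_dvd_mul hd (Nat.gcd_dvd_right M N)

theorem Ideal.sup_span_singleton_add_of_mem {R : Type*} [CommRing R] {J : Ideal R} {j : R}
    (hj : j ∈ J) (a : R) : J ⊔ Ideal.span {a + j} = J ⊔ Ideal.span {a} := by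
  have key : ∀ (b i : R), i ∈ J → J ⊔ Ideal.span {b + i} ≤ J ⊔ Ideal.span {b} := by
    intro b i hi
    refine sup_le le_sup_left ?_
    rw [Ideal.span_singleton_le_iff_mem]
    exact add_mem (Ideal.mem_sup_right (Ideal.mem_span_singleton_self b)) (Ideal.mem_sup_left hi)
  refine le_antisymm (key a j hj) ?_
  simpa using key (a + j) (-j) (neg_mem hj)

theorem ClassGroup.mk0_mem_of_forall_isPrime {R : Type*} [CommRing R] [IsDedekindDomain R]
    (H : Subgroup (ClassGroup R)) {b : Ideal R} (hb : b ≠ ⊥)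
    (h : ∀ (P : Ideal R) (hP : P ≠ ⊥), P.IsPrime → b ≤ P →
      ClassGroup.mk0 ⟨P, mem_nonZeroDivisors_of_ne_zero hP⟩ ∈ H) :
    ClassGroup.mk0 ⟨b, mem_nonZeroDivisors_of_ne_zero hb⟩ ∈ H := by
  induction b using UniqueFactorizationMonoid.induction_on_prime with
  | h₁ => exact absurd rfl hb
  | h₂ I hI =>
    rw [Ideal.isUnit_iff] at hI
    subst hI
    convert H.one_mem
    rw [ClassGroup.mk0_eq_one_iff]
    exact ⟨1, by simp⟩
  | h₃ I P hI0 hP ih =>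
    have hI := ih hI0 fun Q hQ hQp hle => h Q hQ hQp (Ideal.mul_le_right.trans hle)
    have hP' := h P hP.ne_zero (Ideal.isPrime_of_prime hP) Ideal.mul_le_left
    have := H.mul_mem hP' hI
    rwa [← map_mul] at this

section NumberField

variable {K : Type*} [Field K] [NumberField K]

/-- The condition is affine in `t`, so each `g ≠ 1` rules out at most one `t`, and there are
finitely many `g`. -/
theorem NumberField.exists_nat_forall_smul_ne (a : 𝓞 K) {N : ℕ} (hN : N ≠ 0) {θ : 𝓞 K}
    (hθ : ∀ g : K ≃ₐ[ℚ] K, g ≠ 1 → g • θ ≠ θ) :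
    ∃ t : ℕ, ∀ g : K ≃ₐ[ℚ] K, g ≠ 1 →
      g • (a + (N : 𝓞 K) * t * θ) ≠ a + (N : 𝓞 K) * t * θ := by
  have hfin : (⋃ g ∈ {g : K ≃ₐ[ℚ] K | g ≠ 1},
      {t : ℕ | g • (a + (N : 𝓞 K) * t * θ) = a + (N : 𝓞 K) * t * θ}).Finite := by
    refine Set.Finite.biUnion (Set.toFinite _) fun g hg => Set.Subsingleton.finite ?_
    intro t ht s hs
    have hnat : ∀ n : ℕ, g • (n : 𝓞 K) = n := fun n =>
      map_natCast (MulSemiringAction.toRingHom (K ≃ₐ[ℚ] K) (𝓞 K) g) n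
    simp only [Set.mem_ofPred_eq, smul_add, smul_mul', hnat] at ht hs
    have h1 : (N : 𝓞 K) * ((t : 𝓞 K) - s) * (g • θ - θ) = 0 := by linear_combination ht - hs
    rcases mul_eq_zero.1 h1 with h | h
    · rcases mul_eq_zero.1 h with h | h
      · exact absurd h (Nat.cast_ne_zero.2 hN)
      · exact_mod_cast sub_eq_zero.1 h
    · exact absurd (sub_eq_zero.1 h) (hθ g hg)
  obtain ⟨t, ht⟩ := hfin.infinite_compl.nonempty
  refine ⟨t, fun g hg h => ht ?_⟩
  exact Set.mem_biUnion (show g ∈ {g : K ≃ₐ[ℚ] K | g ≠ 1} from hg) h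

/-- The class group of a number field `K` is generated by the classes of the primes that avoid
a given integer `N` and have trivial stabilizer in `Aut(K/ℚ)`. -/
theorem ClassGroup.mem_of_forall_isPrime_of_stabilizer_eq_bot {N : ℕ} (hN : N ≠ 0) {θ : 𝓞 K}
    (hθ : ∀ g : K ≃ₐ[ℚ] K, g ≠ 1 → g • θ ≠ θ) (H : Subgroup (ClassGroup (𝓞 K)))
    (h : ∀ (P : Ideal (𝓞 K)) (hP : P ≠ ⊥), P.IsPrime → (N : 𝓞 K) ∉ P →
      (∀ g : K ≃ₐ[ℚ] K, g • P = P → g = 1) →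
      ClassGroup.mk0 ⟨P, mem_nonZeroDivisors_of_ne_zero hP⟩ ∈ H) (c : ClassGroup (𝓞 K)) :
    c ∈ H := by
  classical
  obtain ⟨I, hI, rfl⟩ := ClassGroup.exists_mk0_eq c
  by_cases hItop : I = ⊤
  · subst hItop
    convert H.one_mem
    rw [ClassGroup.mk0_eq_one_iff]
    exact ⟨1, by simp⟩
  have hnat : ∀ (g : K ≃ₐ[ℚ] K) (n : ℕ), g • (n : 𝓞 K) = n := fun g n =>
    map_natCast (MulSemiringAction.toRingHom (K ≃ₐ[ℚ] K) (𝓞 K) g) n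
  obtain ⟨A, hA⟩ : ∃ A, A = Ideal.absNorm I := ⟨_, rfl⟩
  have hA0 : A ≠ 0 := by rw [hA]; exact mt Ideal.absNorm_eq_zero_iff.1 hI
  have hAI : (A : 𝓞 K) ∈ I := by rw [hA]; exact Ideal.absNorm_mem I
  -- Working modulo `J = A · I`: if `x` generates `I` modulo `J`, then `(x) = I * b` with `b` prime
  -- to `A`.
  obtain ⟨J, hJ⟩ : ∃ J : Ideal (𝓞 K), J = Ideal.span {(A : 𝓞 K)} * I := ⟨_, rfl⟩
  have hJI : J ≤ I := hJ ▸ Ideal.mul_le_right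
  have hJ0 : J ≠ ⊥ := by
    rw [hJ]
    refine mul_ne_zero ?_ hI
    simpa using hA0
  have hAmul : ∀ x ∈ I, (A : 𝓞 K) * x ∈ J := fun x hx =>
    hJ ▸ Ideal.mul_mem_mul (Ideal.mem_span_singleton_self _) hx
  obtain ⟨a', ha'⟩ := IsDedekindDomain.exists_sup_span_eq hJI hJ0
  obtain ⟨t, ht⟩ := NumberField.exists_nat_forall_smul_ne a' (mul_ne_zero hA0 hA0) hθ
  obtain ⟨a, ha⟩ : ∃ a, a = a' + ((A * A : ℕ) : 𝓞 K) * t * θ := ⟨_, rfl⟩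
  rw [← ha] at ht
  have hsup : J ⊔ Ideal.span {a} = I := by
    rw [← ha', ha]
    refine Ideal.sup_span_singleton_add_of_mem ?_ a'
    rw [mul_assoc]
    refine J.mul_mem_right _ ?_
    push_cast
    exact hAmul _ hAI
  have haI : a ∈ I := hsup ▸ Ideal.mem_sup_right (Ideal.mem_span_singleton_self a)
  -- A prime avoiding `D` avoids `N` and separates `a` from all its other conjugates.
  obtain ⟨D, hD⟩ : ∃ D : 𝓞 K, D = N * ∏ g ∈ Finset.univ.erase (1 : K ≃ₐ[ℚ] K), (g • a - a) :=
    ⟨_, rfl⟩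
  have hD0 : D ≠ 0 := by
    rw [hD]
    refine mul_ne_zero (Nat.cast_ne_zero.2 hN) (Finset.prod_ne_zero_iff.2 fun g hg => ?_)
    exact sub_ne_zero.2 (ht g (Finset.ne_of_mem_erase hg))
  have hM0 : Ideal.absNorm (Ideal.span {D}) ≠ 0 :=
    mt Ideal.absNorm_eq_zero_iff.1 (by simpa using hD0)
  -- `m` carries the part of the norm of `D` prime to `A`: a prime containing neither `m` nor `A`
  -- cannot contain `D`.
  obtain ⟨m, e, hm, hdvd⟩ := Nat.exists_coprime_dvd_mul_pow A hM0
  obtain ⟨n, hn1, hn0⟩ := Nat.chineseRemainder (Nat.Coprime.mul_right hm hm) 1 0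
  have hnA : (n : 𝓞 K) ∈ J := by
    obtain ⟨q, hq⟩ := (Nat.modEq_zero_iff_dvd).1 hn0
    rw [hq]
    push_cast
    exact J.mul_mem_right _ (hAmul _ hAI)
  -- As `n ≡ 1` mod `m`, a prime containing `x` cannot contain `m`. As `n ∈ J` and `m` is invertible
  -- mod `A`, `x` still generates `I` modulo `J`. Moreover `g • x - x = m * (g • a - a)`.
  obtain ⟨x, hx⟩ : ∃ x : 𝓞 K, x = n + m * a := ⟨_, rfl⟩
  have hxI : x ∈ I := hx ▸ add_mem (hJI hnA) (I.mul_mem_left _ haI)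
  have hsupx : J ⊔ Ideal.span {x} = I := by
    refine le_antisymm (sup_le hJI ((Ideal.span_singleton_le_iff_mem I).2 hxI)) ?_
    conv_lhs => rw [← hsup]
    refine sup_le le_sup_left ((Ideal.span_singleton_le_iff_mem _).2 ?_)
    have hbez := (Nat.isCoprime_iff_coprime.2 hm)
    obtain ⟨u, w, huw⟩ := hbez
    have huw' : (u : 𝓞 K) * m + w * A = 1 := by exact_mod_cast congrArg (Int.cast : ℤ → 𝓞 K) huw
    have : a = (w * (A * a) - u * n) + u * x := by
      rw [hx]; linear_combination (-a) * huw'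
    rw [this]
    refine add_mem (Ideal.mem_sup_left (sub_mem (J.mul_mem_left _ (hAmul _ haI))
      (J.mul_mem_left _ hnA))) (Ideal.mem_sup_right ?_)
    exact Ideal.mul_mem_left _ _ (Ideal.mem_span_singleton_self x)
  obtain ⟨b, hb⟩ := Ideal.dvd_iff_le.2 ((Ideal.span_singleton_le_iff_mem I).2 hxI)
  have hcop : Ideal.span {(A : 𝓞 K)} ⊔ b = ⊤ := by
    have h1 : I * (Ideal.span {(A : 𝓞 K)} ⊔ b) = I * ⊤ := by
      rw [Ideal.mul_sup, ← hb, mul_comm I, ← hJ, hsupx, Ideal.mul_top]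
    exact mul_left_cancel₀ (show I ≠ 0 from hI) h1
  have hx0 : x ≠ 0 := by
    rintro rfl
    have hb0 : b = ⊥ := by
      rw [Ideal.span_singleton_eq_bot.2 rfl] at hb
      exact (mul_eq_zero.1 hb.symm).resolve_left hI
    rw [hb0, sup_bot_eq, Ideal.span_singleton_eq_top] at hcop
    exact hItop (Ideal.eq_top_of_isUnit_mem I hAI hcop)
  have hb0 : b ≠ ⊥ := by
    rintro rfl
    rw [Ideal.mul_bot, Ideal.span_singleton_eq_bot] at hb
    exact hx0 hb
  suffices hbH : ClassGroup.mk0 ⟨b, mem_nonZeroDivisors_of_ne_zero hb0⟩ ∈ H by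
    have h1 : ClassGroup.mk0 ⟨I, mem_nonZeroDivisors_of_ne_zero hI⟩ =
        (ClassGroup.mk0 ⟨b, mem_nonZeroDivisors_of_ne_zero hb0⟩)⁻¹ := by
      rw [ClassGroup.mk0_eq_mk0_inv_iff]
      exact ⟨x, hx0, hb.symm⟩
    rw [h1]
    exact H.inv_mem hbH
  refine ClassGroup.mk0_mem_of_forall_isPrime H hb0 fun P hP hPp hbP => ?_
  have hxP : x ∈ P := by
    refine hbP (Ideal.mul_le_right (I := I) ?_)
    rw [← hb]
    exact Ideal.mem_span_singleton_self x
  have hAP : (A : 𝓞 K) ∉ P := by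
    intro hAP
    apply hPp.ne_top
    rw [← top_le_iff, ← hcop]
    exact sup_le ((Ideal.span_singleton_le_iff_mem P).2 hAP) hbP
  have hmP : (m : 𝓞 K) ∉ P := by
    intro hmP
    apply hPp.ne_top
    rw [Ideal.eq_top_iff_one]
    have hnP : (n : 𝓞 K) ∈ P := by
      have : (n : 𝓞 K) = x - m * a := by rw [hx]; ring
      rw [this]
      exact sub_mem hxP (P.mul_mem_right _ hmP)
    obtain ⟨q, hq⟩ := (Nat.modEq_iff_dvd.1 hn1)
    have : (1 : 𝓞 K) = n + m * q := by
      have h2 : ((1 : ℤ) : 𝓞 K) = ((n + m * q : ℤ) : 𝓞 K) := by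
        congr 1
        push_cast at hq
        linarith
      exact_mod_cast h2
    rw [this]
    exact add_mem hnP (P.mul_mem_right _ hmP)
  have hDP : D ∉ P := by
    intro hDP
    have hMP : ((Ideal.absNorm (Ideal.span {D}) : ℕ) : 𝓞 K) ∈ P :=
      (Ideal.span_singleton_le_iff_mem P).2 hDP (Ideal.absNorm_mem _)
    obtain ⟨q, hq⟩ := hdvd
    have h2 : (m : 𝓞 K) * (A : 𝓞 K) ^ e ∈ P := by
      have : (m : 𝓞 K) * (A : 𝓞 K) ^ e = (Ideal.absNorm (Ideal.span {D}) : ℕ) * (q : 𝓞 K) := by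
        exact_mod_cast congrArg (Nat.cast : ℕ → 𝓞 K) hq
      rw [this]
      exact P.mul_mem_right _ hMP
    rcases hPp.mem_or_mem h2 with h3 | h3
    · exact hmP h3
    · exact hAP (hPp.mem_of_pow_mem e h3)
  refine h P hP hPp (fun hNP => hDP (hD ▸ P.mul_mem_right _ hNP)) fun g hg => ?_
  by_contra hg1
  have h1 : g • x - x ∈ P := by
    refine sub_mem ?_ hxP
    rw [← hg]
    exact Ideal.smul_mem_pointwise_smul g x P hxP
  have h2 : g • x - x = m * (g • a - a) := by
    rw [hx, smul_add, smul_mul', hnat, hnat]; ring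
  rw [h2] at h1
  rcases hPp.mem_or_mem h1 with h3 | h3
  · exact hmP h3
  · apply hDP
    rw [hD]
    refine P.mul_mem_left _ ?_
    rw [← Finset.mul_prod_erase _ _ (Finset.mem_erase.2 ⟨hg1, Finset.mem_univ g⟩)]
    exact P.mul_mem_right _ h3

end NumberField

/-! ### Power sums and multiplicative characters of finite fields -/

section FiniteField

variable {F : Type*} [Field F] [Fintype F]

theorem FiniteField.sum_pow_of_lt_two_mul {i : ℕ} (hi : i < 2 * (Fintype.card F - 1)) :
    ∑ x : F, x ^ i = if i = Fintype.card F - 1 then -1 else 0 := by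
  classical
  have hq : 1 < Fintype.card F := Fintype.one_lt_card
  rcases Nat.lt_trichotomy i (Fintype.card F - 1) with h | h | h
  · rw [if_neg h.ne, FiniteField.sum_pow_lt_card_sub_one F i h]
  · rw [if_pos h, h]
    have h0 : ∀ x : F, x ^ (Fintype.card F - 1) = if x = 0 then 0 else 1 := by
      intro x
      split_ifs with hx
      · rw [hx, zero_pow (by omega)]
      · exact FiniteField.pow_card_sub_one_eq_one x hx
    simp_rw [h0]
    rw [Finset.sum_ite]
    simp [Finset.filter_ne', Finset.card_erase_of_mem, Nat.cast_sub hq.le]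
  · rw [if_neg h.ne', ← FiniteField.sum_pow_lt_card_sub_one F (i - (Fintype.card F - 1)) (by omega)]
    refine Finset.sum_congr rfl fun x _ => ?_
    by_cases hx : x = 0
    · rw [hx, zero_pow (by omega), zero_pow (by omega)]
    · conv_lhs => rw [show i = (i - (Fintype.card F - 1)) + (Fintype.card F - 1) by omega, pow_add,
        FiniteField.pow_card_sub_one_eq_one x hx, mul_one]

/-- Expanding (1 - x)^b, only the monomial x^(q-1) has a nonzero sum. It occurs exactly when a + b ≥
q - 1, with a binomial coefficient of top entry b < q, hence a unit modulo the prime q. -/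
theorem FiniteField.sum_pow_mul_one_sub_pow_eq_zero_iff (hF : (Fintype.card F).Prime) {a b : ℕ}
    (ha : a < Fintype.card F - 1) (hb : b < Fintype.card F - 1) :
    ∑ x : F, x ^ a * (1 - x) ^ b = 0 ↔ a + b < Fintype.card F - 1 := by
  have hexp : ∑ x : F, x ^ a * (1 - x) ^ b =
      ∑ j ∈ Finset.range (b + 1), ((-1) ^ j * (b.choose j : F)) * ∑ x : F, x ^ (a + j) := by
    simp_rw [Finset.mul_sum]
    rw [Finset.sum_comm]
    refine Finset.sum_congr rfl fun x _ => ?_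
    rw [show (1 - x) = -x + 1 by ring, add_pow, Finset.mul_sum]
    refine Finset.sum_congr rfl fun j _ => ?_
    rw [neg_pow, one_pow, pow_add]
    ring
  have hsum : ∀ j ∈ Finset.range (b + 1), ((-1) ^ j * (b.choose j : F)) * ∑ x : F, x ^ (a + j) =
      if a + j = Fintype.card F - 1 then -((-1) ^ j * (b.choose j : F)) else 0 := by
    intro j hj
    rw [Finset.mem_range] at hj
    rw [FiniteField.sum_pow_of_lt_two_mul (by omega)]
    split_ifs <;> ring
  rw [hexp, Finset.sum_congr rfl hsum]
  constructor
  · intro h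
    by_contra hlt
    rw [Finset.sum_eq_single (Fintype.card F - 1 - a)] at h
    · rw [if_pos (by omega), neg_eq_zero, mul_eq_zero] at h
      rcases h with h | h
      · exact absurd h (pow_ne_zero _ (neg_ne_zero.2 one_ne_zero))
      · have := Fact.mk hF
        have hchar : CharP F (Fintype.card F) := charP_of_card_eq_prime rfl
        rw [CharP.cast_eq_zero_iff F (Fintype.card F)] at h
        have h3 : (Fintype.card F) ∣ b.factorial := by
          rw [← Nat.choose_mul_factorial_mul_factorial
            (show Fintype.card F - 1 - a ≤ b by omega), mul_assoc]
          exact h.mul_right _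
        rw [hF.dvd_factorial] at h3
        omega
    · intro j _ hj
      rw [if_neg (by omega)]
    · intro hj
      exact absurd (Finset.mem_range.2 (by omega)) hj
  · intro h
    refine Finset.sum_eq_zero fun j hj => ?_
    rw [Finset.mem_range] at hj
    rw [if_neg (by omega)]

/-- The p-th power residue character: for a generator `g` of the unit group, `g ^ n` is a p-th root
of unity, hence some `f ζ ^ j`, and `g` is sent to `ζ ^ j`. -/
theorem MulChar.exists_map_eq_pow {R : Type*} [CommRing R] {p n : ℕ} [NeZero p] (f : R →+* F)
    {ζ : R} (hζ : ζ ^ p = 1) (hf : IsPrimitiveRoot (f ζ) p) (hn : Fintype.card F - 1 = n * p) :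
    ∃ χ : MulChar F R, (∀ x, f (χ x) = x ^ n) ∧ ∀ x ≠ 0, χ x ^ p = 1 := by
  classical
  have hq : 1 < Fintype.card F := Fintype.one_lt_card
  have hn0 : n ≠ 0 := by rintro rfl; omega
  obtain ⟨g, hg⟩ := IsCyclic.exists_generator (α := Fˣ)
  have hcard : Fintype.card Fˣ = n * p := by rw [Fintype.card_units, hn]
  have hgp : (((g : F)) ^ n) ^ p = 1 := by
    rw [← pow_mul, ← hn]
    exact FiniteField.pow_card_sub_one_eq_one _ g.ne_zero
  obtain ⟨j, _, hj⟩ := hf.eq_pow_of_pow_eq_one hgp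
  let u : Rˣ := Units.ofPowEqOne ζ p hζ (NeZero.ne p)
  have hu : ((u ^ j : Rˣ) : R) = ζ ^ j := by simp [u]
  have hup : (u ^ j) ^ p = 1 := by
    ext
    rw [Units.val_pow_eq_pow_val, hu, ← pow_mul, mul_comm, pow_mul, hζ, one_pow, Units.val_one]
  have hmem : u ^ j ∈ rootsOfUnity (Fintype.card Fˣ) R := by
    rw [mem_rootsOfUnity, hcard, mul_comm, pow_mul, hup, one_pow]
  let χ : MulChar F R := MulChar.ofRootOfUnity hmem hg
  have hχ : χ g = ζ ^ j := by rw [← hu]; exact MulChar.ofRootOfUnity_spec hmem hg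
  have hpow : ∀ x : F, x ≠ 0 → ∃ k : ℕ, x = (g : F) ^ k := by
    intro x hx
    obtain ⟨k, hk⟩ := (mem_powers_iff_mem_zpowers.2 (hg (Units.mk0 x hx)))
    refine ⟨k, ?_⟩
    simpa using (congrArg Units.val hk).symm
  refine ⟨χ, fun x => ?_, fun x hx => ?_⟩
  · by_cases hx : x = 0
    · rw [hx, MulChar.map_zero, map_zero, zero_pow hn0]
    · obtain ⟨k, rfl⟩ := hpow x hx
      rw [map_pow, hχ, map_pow, map_pow, hj, ← pow_mul, ← pow_mul, mul_comm]
  · obtain ⟨k, rfl⟩ := hpow x hx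
    rw [map_pow, hχ, ← pow_mul, ← pow_mul, show j * (k * p) = p * (j * k) by ring, pow_mul, hζ,
      one_pow]

end FiniteField

theorem Ideal.eq_prod_filter_dvd_of_dvd_prod {R ι : Type*} [CommRing R] [IsDedekindDomain R]
    [Fintype ι] {P : ι → Ideal R} (hP : ∀ i, (P i).IsPrime) (hP0 : ∀ i, P i ≠ ⊥)
    (hinj : Function.Injective P) {I : Ideal R} (hI : I ∣ ∏ i, P i)
    [DecidablePred fun i => I ≤ P i] :
    I = ∏ i ∈ Finset.univ.filter (fun i => I ≤ P i), P i := by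
  classical
  have hmax : ∀ i, (P i).IsMaximal := fun i =>
    Ring.DimensionLEOne.maximalOfPrime (hP0 i) (hP i)
  have h1 : ∏ i ∈ Finset.univ.filter (fun i => I ≤ P i), P i ∣ I := by
    refine Finset.prod_dvd_of_coprime ?_ fun i hi => ?_
    · intro i _ j _ hij
      exact Ideal.isCoprime_of_isMaximal (hinj.ne hij)
    · exact Ideal.dvd_iff_le.2 (Finset.mem_filter.1 hi).2
  have h2 : I ∣ ∏ i ∈ Finset.univ.filter (fun i => I ≤ P i), P i := by
    rw [← Finset.prod_filter_mul_prod_filter_not Finset.univ (fun i => I ≤ P i)] at hI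
    refine IsCoprime.dvd_of_dvd_mul_right ?_ hI
    refine IsCoprime.prod_right fun i hi => ?_
    rw [Ideal.isCoprime_iff_sup_eq, sup_comm]
    exact (hmax i).out.2 _ (left_lt_sup.2 (Finset.mem_filter.1 hi).2)
  exact dvd_antisymm h2 h1

theorem Ideal.perfectField_residueField_of_finite_quotient {R : Type*} [CommRing R] (p : Ideal R)
    [p.IsMaximal] [Finite (R ⧸ p)] : PerfectField p.ResidueField := by
  have : Finite p.ResidueField :=
    Finite.of_surjective _ (Ideal.bijective_algebraMap_quotient_residueField p).2
  infer_instance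

theorem NumberField.perfectField_residueField {K : Type*} [Field K] [NumberField K]
    (p : Ideal (𝓞 K)) (hp : p ≠ ⊥) [p.IsPrime] : PerfectField p.ResidueField := by
  have : p.IsMaximal := Ring.DimensionLEOne.maximalOfPrime hp inferInstance
  have : Finite (𝓞 K ⧸ p) := Ideal.finiteQuotientOfFreeOfNeBot p hp
  exact Ideal.perfectField_residueField_of_finite_quotient p

theorem Int.perfectField_residueField (p : Ideal ℤ) (hp : p ≠ ⊥) [p.IsPrime] :
    PerfectField p.ResidueField := by
  have : p.IsMaximal := Ring.DimensionLEOne.maximalOfPrime hp inferInstance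
  have : Finite (ℤ ⧸ p) := Ideal.finiteQuotientOfFreeOfNeBot p hp
  exact Ideal.perfectField_residueField_of_finite_quotient p

/-! ### Norms of ideals and primes of degree one -/

section NumberField

variable {K : Type*} [Field K] [NumberField K] [IsGalois ℚ K]

theorem NumberField.prod_smul_eq_span_absNorm (I : Ideal (𝓞 K)) :
    ∏ g : K ≃ₐ[ℚ] K, g • I = Ideal.span {(Ideal.absNorm I : 𝓞 K)} := by
  have := Ideal.map_relNorm_eq_prod_smul (R := ℤ) (S := 𝓞 K) (G := K ≃ₐ[ℚ] K)
    (fun p hp _ => Int.perfectField_residueField p hp) I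
  rw [← this, Ideal.relNorm_int, Ideal.map_span]
  simp

/-- The decomposition group has order e f, so its triviality forces residue degree 1. -/
theorem NumberField.prime_absNorm_of_stabilizer_eq_bot {P : Ideal (𝓞 K)} (hP : P ≠ ⊥)
    [P.IsPrime] (h : ∀ g : K ≃ₐ[ℚ] K, g • P = P → g = 1) : (Ideal.absNorm P).Prime := by
  have hu : P.under ℤ ≠ ⊥ := mt Ideal.eq_bot_of_comap_eq_bot hP
  have := Int.perfectField_residueField (P.under ℤ) hu
  have hcard := Ideal.card_stabilizer_eq_card_inertia_mul_finrank (G := K ≃ₐ[ℚ] K) (P.under ℤ) P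
  have hstab : MulAction.stabilizer (K ≃ₐ[ℚ] K) P = ⊥ := by
    rw [eq_bot_iff]
    intro g hg
    exact h g hg
  rw [hstab, Subgroup.card_bot] at hcard
  have hf : P.inertiaDeg ℤ = 1 := (mul_eq_one.1 hcard.symm).2
  obtain ⟨l, hl⟩ : ∃ l : ℕ, P.under ℤ = Ideal.span {(l : ℤ)} := by
    refine ⟨Ideal.absNorm (P.under ℤ), ?_⟩
    exact (Int.ideal_span_absNorm_eq_self _).symm
  have : P.LiesOver (Ideal.span {(l : ℤ)}) := ⟨hl.symm⟩
  have hlp : Prime (l : ℤ) := by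
    rw [← Ideal.span_singleton_prime, ← hl]
    · infer_instance
    · rintro h0
      apply hu
      rw [hl, h0, Ideal.span_singleton_eq_bot.2 rfl]
  rw [← Ideal.pow_inertiaDeg l P, hf, pow_one]
  exact Nat.prime_iff_prime_int.2 hlp

end NumberField

/-! ### Prime factors of Jacobi sums -/

section Jacobi

variable {p : ℕ} [hp : Fact p.Prime] {K : Type*} [Field K] [NumberField K]
  [IsCyclotomicExtension {p} ℚ K]

open IsCyclotomicExtension.Rat

/-- The integer `a ∈ {1, …, p - 1}` such that `g⁻¹` raises `p`-th roots of unity to the power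
`a`. -/
noncomputable def cyclotomicInvExponent (p : ℕ) [Fact p.Prime] {K : Type*} [Field K]
    [NumberField K] [IsCyclotomicExtension {p} ℚ K] (g : K ≃ₐ[ℚ] K) : ℕ :=
  ((galEquivZMod p K g⁻¹ : (ZMod p)ˣ) : ZMod p).val

theorem cyclotomicInvExponent_lt (g : K ≃ₐ[ℚ] K) : cyclotomicInvExponent p g < p :=
  ZMod.val_lt _

theorem cyclotomicInvExponent_pos (g : K ≃ₐ[ℚ] K) : 0 < cyclotomicInvExponent p g :=
  ZMod.val_pos.2 (Units.ne_zero _)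

/-- The witness is the Jacobi sum of χ and χ^k for the residue character χ of P. Its product with
the sum of the inverse characters is the norm of P, as χ, χ^k and χ^(k+1) are nontrivial. Applying
g⁻¹ and reducing modulo P turns it into a power sum whose vanishing is known. -/
theorem NumberField.exists_dvd_absNorm_mem_smul_iff {P : Ideal (𝓞 K)} (hP : P ≠ ⊥) [P.IsPrime]
    (hpP : (p : 𝓞 K) ∉ P) (h : ∀ g : K ≃ₐ[ℚ] K, g • P = P → g = 1) {k : ℕ} (hk : 1 ≤ k)
    (hkp : k + 1 < p) :
    ∃ J : 𝓞 K, J ∣ (Ideal.absNorm P : 𝓞 K) ∧ ∀ g : K ≃ₐ[ℚ] K, J ∈ g • P ↔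
      cyclotomicInvExponent p g + k * cyclotomicInvExponent p g % p < p := by
  classical
  have : IsGalois ℚ K := IsCyclotomicExtension.isGalois {p} ℚ K
  have hPm : P.IsMaximal := Ring.DimensionLEOne.maximalOfPrime hP inferInstance
  let _ : Field (𝓞 K ⧸ P) := Ideal.Quotient.field P
  have : Finite (𝓞 K ⧸ P) := Ideal.finiteQuotientOfFreeOfNeBot P hP
  let _ : Fintype (𝓞 K ⧸ P) := Fintype.ofFinite _
  have hcard : Fintype.card (𝓞 K ⧸ P) = Ideal.absNorm P := by
    rw [Ideal.absNorm_apply, Submodule.cardQuot_apply, Nat.card_eq_fintype_card]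
  have hprime : (Fintype.card (𝓞 K ⧸ P)).Prime :=
    hcard ▸ NumberField.prime_absNorm_of_stabilizer_eq_bot hP h
  let f := Ideal.Quotient.mk P
  obtain ⟨ζ, hζ⟩ : ∃ ζ : 𝓞 K, IsPrimitiveRoot ζ p :=
    ⟨_, (IsCyclotomicExtension.zeta_spec p ℚ K).toInteger_isPrimitiveRoot⟩
  have hfζ : IsPrimitiveRoot (f ζ) p := by
    have : NeZero (p : 𝓞 K ⧸ P) := by
      refine ⟨fun h0 => hpP ?_⟩
      rwa [← Ideal.Quotient.eq_zero_iff_mem, map_natCast]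
    rw [← Polynomial.isRoot_cyclotomic_iff, ← Polynomial.map_cyclotomic p f]
    exact (hζ.isRoot_cyclotomic hp.out.pos).map
  obtain ⟨n, hn⟩ : p ∣ Fintype.card (𝓞 K ⧸ P) - 1 :=
    hfζ.dvd_of_pow_eq_one _ (FiniteField.pow_card_sub_one_eq_one _
      (hfζ.ne_zero hp.out.ne_zero))
  rw [mul_comm] at hn
  have hn0 : 0 < n := by
    rcases Nat.eq_zero_or_pos n with rfl | h0
    · have := hprime.two_le
      omega
    · exact h0
  obtain ⟨χ, hχ, hχp⟩ := MulChar.exists_map_eq_pow f hζ.pow_eq_one hfζ hn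
  have hne : ∀ a : ℕ, 0 < a → a < p → χ ^ a ≠ 1 := by
    intro a ha hap h1
    obtain ⟨g, hg⟩ := IsCyclic.exists_generator (α := (𝓞 K ⧸ P)ˣ)
    have h2 : ((g : 𝓞 K ⧸ P)) ^ (n * a) = 1 := by
      rw [pow_mul, ← hχ, ← map_pow, ← MulChar.pow_apply' _ ha.ne', h1,
        MulChar.one_apply_coe, map_one]
    have h3 : g ^ (n * a) = 1 := by ext; simpa using h2
    have h4 := Nat.le_of_dvd (Nat.mul_pos hn0 ha) (orderOf_dvd_of_pow_eq_one h3)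
    rw [orderOf_eq_card_of_forall_mem_zpowers hg, Nat.card_eq_fintype_card, Fintype.card_units,
      hn] at h4
    exact absurd (Nat.le_of_mul_le_mul_left h4 hn0) (not_le.2 hap)
  refine ⟨jacobiSum χ (χ ^ k), ⟨jacobiSum χ⁻¹ (χ ^ k)⁻¹, ?_⟩, fun g => ?_⟩
  · let i := algebraMap (𝓞 K) K
    have hi : Function.Injective i := FaithfulSMul.algebraMap_injective _ _
    apply hi
    have hchar : ringChar K ≠ ringChar (𝓞 K ⧸ P) := by
      have : CharZero K := inferInstance
      rw [ringChar.eq_zero]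
      exact fun h0 => CharP.ringChar_ne_zero_of_finite (𝓞 K ⧸ P) h0.symm
    have hne' : ∀ ψ : MulChar (𝓞 K ⧸ P) (𝓞 K), ψ ≠ 1 → ψ.ringHomComp i ≠ 1 := by
      intro ψ hψ
      rwa [Ne, MulChar.ringHomComp_eq_one_iff hi]
    have h1 := jacobiSum_mul_jacobiSum_inv hchar (hne' χ (by simpa using hne 1 one_pos (by omega)))
      (hne' (χ ^ k) (hne k hk (by omega))) (by
        rw [← MulChar.ringHomComp_mul, ← pow_succ']
        exact hne' _ (hne (k + 1) (by omega) hkp))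
    rw [MulChar.ringHomComp_inv, MulChar.ringHomComp_inv, jacobiSum_ringHomComp,
      jacobiSum_ringHomComp] at h1
    rw [map_mul, h1, hcard, map_natCast]
  · rw [Ideal.mem_pointwise_smul_iff_inv_smul_mem, ← Ideal.Quotient.eq_zero_iff_mem]
    obtain ⟨a, ha⟩ : ∃ a, a = cyclotomicInvExponent p g := ⟨_, rfl⟩
    have ha0 : 0 < a := ha ▸ cyclotomicInvExponent_pos g
    have hap : a < p := ha ▸ cyclotomicInvExponent_lt g
    have hka0 : 0 < k * a % p := by
      rw [Nat.pos_iff_ne_zero, Ne, ← Nat.dvd_iff_mod_eq_zero, hp.out.dvd_mul]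
      rintro (h0 | h0)
      · exact absurd (Nat.le_of_dvd hk h0) (by omega)
      · exact absurd (Nat.le_of_dvd ha0 h0) (by omega)
    have hkap : k * a % p < p := Nat.mod_lt _ hp.out.pos
    have hact : ∀ x, g⁻¹ • χ x = χ x ^ a := by
      intro x
      by_cases hx : x = 0
      · rw [hx, MulChar.map_zero, smul_zero, zero_pow ha0.ne']
      · rw [galEquivZMod_smul_of_pow_eq p K g⁻¹ (hχp x hx), ha]
        rfl
    -- Exponents of the form `n * c` depend only on `c` mod `p` for nonzero `x`, since `n * p` is
    -- the order of the unit group; positivity of both exponents handles `x = 0`.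
    have hmod : ∀ x : 𝓞 K ⧸ P, x ^ (n * (k * a)) = x ^ (n * (k * a % p)) := by
      intro x
      by_cases hx : x = 0
      · rw [hx, zero_pow, zero_pow]
        · exact (Nat.mul_pos hn0 hka0).ne'
        · exact (Nat.mul_pos hn0 (Nat.mul_pos hk ha0)).ne'
      · conv_lhs => rw [← Nat.div_add_mod (k * a) p, mul_add, pow_add, ← mul_assoc, pow_mul, ← hn,
          FiniteField.pow_card_sub_one_eq_one x hx, one_pow, one_mul]
    have hsum : Ideal.Quotient.mk P (g⁻¹ • jacobiSum χ (χ ^ k)) =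
        ∑ x : 𝓞 K ⧸ P, x ^ (n * a) * (1 - x) ^ (n * (k * a % p)) := by
      rw [jacobiSum, Finset.smul_sum, map_sum]
      refine Finset.sum_congr rfl fun x _ => ?_
      rw [smul_mul', MulChar.pow_apply' _ (by omega), smul_pow', hact, hact, map_mul, ← pow_mul,
        map_pow, map_pow]
      change f (χ x) ^ a * f (χ (1 - x)) ^ (a * k) = _
      rw [hχ, hχ, ← pow_mul, ← pow_mul, mul_comm a k, hmod]
    have hlt : ∀ c : ℕ, n * c < Fintype.card (𝓞 K ⧸ P) - 1 ↔ c < p := by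
      intro c
      rw [hn]
      exact Nat.mul_lt_mul_left hn0
    rw [hsum, FiniteField.sum_pow_mul_one_sub_pow_eq_zero_iff hprime ((hlt _).2 hap)
      ((hlt _).2 hkap), ← mul_add, hlt, ha]

end Jacobi

/-! ### Stickelberger's theorem -/

section Stickelberger

open IsCyclotomicExtension.Rat PClassGroup

variable {p : ℕ} [hp : Fact p.Prime] {K : Type*} [Field K] [NumberField K]

theorem PClassGroup.prod_classAct_mk0 {P : Ideal (𝓞 K)} (hP : P ≠ ⊥) (s : Finset (K ≃ₐ[ℚ] K))
    {I : Ideal (𝓞 K)} (hI : I ≠ ⊥) (h : I = ∏ g ∈ s, g • P) :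
    ∏ g ∈ s, classAct g (ClassGroup.mk0 ⟨P, mem_nonZeroDivisors_of_ne_zero hP⟩) =
      ClassGroup.mk0 ⟨I, mem_nonZeroDivisors_of_ne_zero hI⟩ := by
  simp_rw [classAct_mk0 _ hP]
  rw [← map_prod]
  congr 1
  ext1
  simp [h]

variable [IsCyclotomicExtension {p} ℚ K]

/-- The conjugates of P are distinct and the Jacobi sum divides their product, the principal ideal
of the norm. So the conjugates containing the sum multiply to a principal ideal, and so do the
remaining ones, which appear here. -/
theorem PClassGroup.prod_classAct_mk0_filter {P : Ideal (𝓞 K)} (hP : P ≠ ⊥) [P.IsPrime]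
    (hpP : (p : 𝓞 K) ∉ P) (h : ∀ g : K ≃ₐ[ℚ] K, g • P = P → g = 1) {k : ℕ} (hk : 1 ≤ k)
    (hkp : k + 1 < p) :
    ∏ g ∈ Finset.univ.filter (fun g : K ≃ₐ[ℚ] K =>
        p ≤ cyclotomicInvExponent p g + k * cyclotomicInvExponent p g % p),
      classAct g (ClassGroup.mk0 ⟨P, mem_nonZeroDivisors_of_ne_zero hP⟩) = 1 := by
  classical
  have : IsGalois ℚ K := IsCyclotomicExtension.isGalois {p} ℚ K
  obtain ⟨J, hJ, hmem⟩ := NumberField.exists_dvd_absNorm_mem_smul_iff hP hpP h hk hkp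
  have hN0 : (Ideal.absNorm P : 𝓞 K) ≠ 0 :=
    Nat.cast_ne_zero.2 (mt Ideal.absNorm_eq_zero_iff.1 hP)
  have hJ0 : J ≠ 0 := by rintro rfl; exact hN0 (zero_dvd_iff.1 hJ)
  have hspan0 : Ideal.span {J} ≠ ⊥ := by simpa using hJ0
  have hspanN0 : Ideal.span {(Ideal.absNorm P : 𝓞 K)} ≠ ⊥ := by simpa using hN0
  have hprod := NumberField.prod_smul_eq_span_absNorm P
  have hfac := Ideal.eq_prod_filter_dvd_of_dvd_prod (P := fun g : K ≃ₐ[ℚ] K => g • P)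
    (fun g => (Ideal.IsPrime.smul_iff g).2 inferInstance) (fun g => Ideal.smul_ne_bot g hP)
    (fun g g' hgg => by
      have h1 : (g'⁻¹ * g) • P = P := by
        rw [mul_smul]
        exact inv_smul_eq_iff.2 hgg
      exact (inv_mul_eq_one.1 (h _ h1)).symm)
    (show Ideal.span {J} ∣ ∏ g : K ≃ₐ[ℚ] K, g • P by
      rw [hprod, Ideal.dvd_iff_le, Ideal.span_singleton_le_span_singleton]
      exact hJ)
  have hprin : ∀ (x : 𝓞 K) (hx : Ideal.span {x} ≠ ⊥),
      ClassGroup.mk0 ⟨Ideal.span {x}, mem_nonZeroDivisors_of_ne_zero hx⟩ = 1 := by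
    intro x hx
    rw [ClassGroup.mk0_eq_one_iff]
    exact ⟨x, rfl⟩
  have h1 := (prod_classAct_mk0 hP _ hspan0 hfac).trans (hprin J hspan0)
  have h2 := (prod_classAct_mk0 hP _ hspanN0 hprod.symm).trans (hprin _ hspanN0)
  rw [← Finset.prod_filter_mul_prod_filter_not Finset.univ
    (fun g : K ≃ₐ[ℚ] K => Ideal.span {J} ≤ g • P), h1, one_mul] at h2
  rw [← h2]
  refine Finset.prod_congr (Finset.filter_congr fun g _ => ?_) fun _ _ => rfl
  rw [Ideal.span_singleton_le_iff_mem, hmem, not_lt]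

/-- The carry in a + (b a mod p) is the increment of ⌊b a / p⌋, so the Jacobi sum relations
telescope to Stickelberger's. -/
theorem Nat.succ_mul_div_eq_add_ite {a p : ℕ} (ha : a < p) (b : ℕ) :
    (b + 1) * a / p = b * a / p + if p ≤ a + b * a % p then 1 else 0 := by
  have hp : 0 < p := by omega
  have hr := Nat.mod_lt (b * a) hp
  have h1 : (b + 1) * a = p * (b * a / p) + (a + b * a % p) := by
    have := Nat.div_add_mod (b * a) p
    linarith [add_mul b 1 a]
  rw [h1, Nat.mul_add_div hp]
  congr 1
  split_ifs with h
  · rw [Nat.div_eq_of_lt_le] <;> omega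
  · exact Nat.div_eq_of_lt (by omega)

theorem IsCyclotomicExtension.Rat.eq_one_of_smul_eq {θ : 𝓞 K} (hθ : IsPrimitiveRoot θ p)
    (g : K ≃ₐ[ℚ] K) (hg : g • θ = θ) : g = 1 := by
  rw [galEquivZMod_smul_of_pow_eq p K g hθ.pow_eq_one] at hg
  have h1 := hθ.pow_inj (ZMod.val_lt _) hp.out.one_lt (hg.trans (pow_one θ).symm)
  have h2 : galEquivZMod p K g = 1 := by
    ext
    rw [← ZMod.natCast_zmod_val ((galEquivZMod p K g : (ZMod p)ˣ) : ZMod p), h1]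
    simp
  exact (map_eq_one_iff _ (galEquivZMod p K).injective).1 h2

/-- **Stickelberger's theorem** for the field of `p`-th roots of unity: the element
`∑ ⌊b a / p⌋ σ_a⁻¹` of the group ring annihilates the class group. -/
theorem PClassGroup.prod_classAct_pow_mul_div_eq_one (c : ClassGroup (𝓞 K)) {b : ℕ}
    (hb : 1 ≤ b) (hbp : b < p) :
    ∏ g : K ≃ₐ[ℚ] K, (classAct g c) ^ (b * cyclotomicInvExponent p g / p) = 1 := by
  classical
  obtain ⟨Φ, hΦ⟩ : ∃ Φ : ClassGroup (𝓞 K) →* ClassGroup (𝓞 K),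
      ∀ c, Φ c = ∏ g : K ≃ₐ[ℚ] K, (classAct g c) ^ (b * cyclotomicInvExponent p g / p) := by
    refine ⟨∏ g : K ≃ₐ[ℚ] K, (powMonoidHom (b * cyclotomicInvExponent p g / p)).comp
      (classAct g).toMonoidHom, fun c => ?_⟩
    rw [MonoidHom.finsetProd_apply]
    rfl
  rw [← hΦ, ← MonoidHom.mem_ker]
  have hζ : IsPrimitiveRoot (IsCyclotomicExtension.zeta_spec p ℚ K).toInteger p :=
    (IsCyclotomicExtension.zeta_spec p ℚ K).toInteger_isPrimitiveRoot
  refine ClassGroup.mem_of_forall_isPrime_of_stabilizer_eq_bot hp.out.ne_zero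
    (fun g hg hgθ => hg (eq_one_of_smul_eq hζ g hgθ)) Φ.ker (fun P hP hPp hpP hst => ?_) c
  rw [MonoidHom.mem_ker, hΦ]
  clear hΦ Φ
  induction b, hb using Nat.le_induction with
  | base =>
    refine Finset.prod_eq_one fun g _ => ?_
    rw [one_mul, Nat.div_eq_of_lt (cyclotomicInvExponent_lt g), pow_zero]
  | succ b hb ih =>
    simp_rw [Nat.succ_mul_div_eq_add_ite (cyclotomicInvExponent_lt (p := p) (K := K) _), pow_add]
    rw [Finset.prod_mul_distrib, ih (by omega), one_mul]
    simp_rw [pow_ite, pow_one, pow_zero]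
    rw [← Finset.prod_filter]
    exact prod_classAct_mk0_filter hP hpP hst hb hbp

end Stickelberger

/-! ### Stickelberger relations on eigenvectors -/

section Eigenvalue

open IsCyclotomicExtension.Rat PClassGroup

variable {p : ℕ} [hp : Fact p.Prime] {K : Type*} [Field K] [NumberField K]

theorem PClassGroup.classAct_pow_of_eq_pow {σ : K ≃ₐ[ℚ] K} {c : ClassGroup (𝓞 K)} {n : ℕ}
    (h : classAct σ c = c ^ n) (i : ℕ) : classAct (σ ^ i) c = c ^ (n ^ i) := by
  induction i with
  | zero => simp [classAct_one]
  | succ i ih => rw [pow_succ, classAct_mul, h, map_pow, ih, ← pow_mul, pow_succ]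

variable [IsCyclotomicExtension {p} ℚ K]

theorem IsCyclotomicExtension.Rat.galEquivZMod_eq_of_apply {ζ : K} (hζ : IsPrimitiveRoot ζ p)
    {σ : K ≃ₐ[ℚ] K} {v : (ZMod p)ˣ} (hσ : σ ζ = ζ ^ ((v : ZMod p).val)) :
    galEquivZMod p K σ = v := by
  have h1 := galEquivZMod_apply_of_pow_eq p K σ hζ.pow_eq_one
  rw [hσ] at h1
  ext
  exact (ZMod.val_injective p (hζ.pow_inj (ZMod.val_lt _) (ZMod.val_lt _) h1)).symm

theorem IsCyclotomicExtension.Rat.mem_zpowers_of_orderOf {σ : K ≃ₐ[ℚ] K} {v : (ZMod p)ˣ}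
    (hv : orderOf v = p - 1) (hσ : galEquivZMod p K σ = v) (g : K ≃ₐ[ℚ] K) :
    g ∈ Subgroup.zpowers σ := by
  have h1 : Subgroup.zpowers v = ⊤ := by
    rw [← Subgroup.card_eq_iff_eq_top, Nat.card_zpowers, hv, Nat.card_eq_fintype_card,
      ZMod.card_units]
  have h2 : galEquivZMod p K g ∈ Subgroup.zpowers v := h1 ▸ Subgroup.mem_top _
  obtain ⟨n, hn⟩ := Subgroup.mem_zpowers_iff.1 h2
  refine Subgroup.mem_zpowers_iff.2 ⟨n, (galEquivZMod p K).injective ?_⟩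
  rw [map_zpow, hσ, hn]

theorem IsCyclotomicExtension.Rat.prod_univ_eq_prod_range {σ : K ≃ₐ[ℚ] K} {v : (ZMod p)ˣ}
    (hv : orderOf v = p - 1) (hσ : galEquivZMod p K σ = v) {M : Type*} [CommMonoid M]
    (f : (K ≃ₐ[ℚ] K) → M) : ∏ g, f g = ∏ i ∈ Finset.range (p - 1), f (σ ^ i) := by
  classical
  have ho : orderOf σ = p - 1 := by
    rw [← hv, ← hσ]
    exact ((galEquivZMod p K).orderOf_eq σ).symm
  rw [← IsCyclic.image_range_orderOf (mem_zpowers_of_orderOf hv hσ), ho, Finset.prod_image]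
  intro i hi j hj hij
  rw [Finset.coe_range, ← ho] at hi hj
  exact pow_injOn_Iio_orderOf hi hj hij

/-- If `σ` acts on a class of order `p` with eigenvalue `μ`, then every Stickelberger element
vanishes at `μ`. -/
theorem PClassGroup.sum_pow_mul_div_eq_zero {σ : K ≃ₐ[ℚ] K} {v : (ZMod p)ˣ}
    (hv : orderOf v = p - 1) (hσ : galEquivZMod p K σ = v) {c : ClassGroup (𝓞 K)}
    (hc : orderOf c = p) {μ : (ZMod p)ˣ} (hμ : classAct σ c = c ^ ((μ : ZMod p).val)) {b : ℕ}
    (hb : 1 ≤ b) (hbp : b < p) :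
    ∑ i ∈ Finset.range (p - 1),
      (μ : ZMod p) ^ i * ((b * (((v ^ i)⁻¹ : (ZMod p)ˣ) : ZMod p).val / p : ℕ) : ZMod p) = 0 := by
  have h := prod_classAct_pow_mul_div_eq_one (p := p) c hb hbp
  rw [prod_univ_eq_prod_range hv hσ] at h
  simp_rw [classAct_pow_of_eq_pow hμ, ← pow_mul] at h
  rw [Finset.prod_pow_eq_pow_sum, ← orderOf_dvd_iff_pow_eq_one, hc,
    ← CharP.cast_eq_zero_iff (ZMod p)] at h
  rw [← h]
  simp only [Nat.cast_sum, Nat.cast_mul, Nat.cast_pow]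
  refine Finset.sum_congr rfl fun i _ => ?_
  rw [ZMod.natCast_zmod_val, cyclotomicInvExponent, map_inv, map_pow, hσ]

end Eigenvalue

/-! ### The coefficients of `Q` as Stickelberger coefficients -/

section Delta

open PClassGroup

variable {p : ℕ} [hp : Fact p.Prime]

theorem PClassGroup.res_neg_natCast (v : (ZMod p)ˣ) (i : ℕ) :
    res v (-(i : ℤ)) = ((((v ^ i)⁻¹ : (ZMod p)ˣ) : ZMod p).val : ℤ) := by
  rw [res, zpow_neg, zpow_natCast]

/-- Division of v · v^{-i} by p has remainder v^{-(i-1)}, so δ_i is minus the quotient. -/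
theorem PClassGroup.delta_natCast (v : (ZMod p)ˣ) (i : ℕ) :
    delta v i =
      -(((v : ZMod p).val * (((v ^ i)⁻¹ : (ZMod p)ˣ) : ZMod p).val / p : ℕ) : ℤ) := by
  have hp0 : (p : ℤ) ≠ 0 := Nat.cast_ne_zero.2 hp.out.ne_zero
  have h1 : res v (-((i : ℤ) - 1)) =
      (((v : ZMod p).val * (((v ^ i)⁻¹ : (ZMod p)ˣ) : ZMod p).val % p : ℕ) : ℤ) := by
    rw [res, ← ZMod.val_mul, ← Units.val_mul, neg_sub, sub_eq_add_neg, zpow_add, zpow_one,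
      zpow_neg, zpow_natCast]
  have h2 : res v 1 = ((v : ZMod p).val : ℤ) := by rw [res, zpow_one]
  apply mul_left_cancel₀ hp0
  rw [mul_delta, h1, h2, res_neg_natCast]
  have h3 := Nat.div_add_mod ((v : ZMod p).val * (((v ^ i)⁻¹ : (ZMod p)ˣ) : ZMod p).val) p
  have h4 := congrArg (Nat.cast : ℕ → ℤ) h3
  push_cast at h4 ⊢
  linarith

theorem PClassGroup.sum_delta_mul_pow (v : (ZMod p)ˣ) (x : ZMod p) :
    ∑ i ∈ Finset.Icc 1 (p - 2), ((delta v (i : ℤ) : ℤ) : ZMod p) * x ^ i =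
      -∑ i ∈ Finset.range (p - 1), x ^ i *
        (((v : ZMod p).val * (((v ^ i)⁻¹ : (ZMod p)ˣ) : ZMod p).val / p : ℕ) : ZMod p) := by
  have hp2 := hp.out.two_le
  have hIcc : Finset.Icc 1 (p - 2) = Finset.Ico 1 (p - 1) := by
    ext i
    simp only [Finset.mem_Icc, Finset.mem_Ico]
    omega
  have : Fact (1 < p) := ⟨hp.out.one_lt⟩
  rw [Finset.range_eq_Ico, Finset.sum_eq_sum_Ico_succ_bot (by omega), hIcc, zero_add]
  -- The missing index 0 contributes nothing because v < p, so `Q` starting at 1 is the full sum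
  -- over the Galois group.
  have h0 : (v : ZMod p).val * (((v ^ 0)⁻¹ : (ZMod p)ˣ) : ZMod p).val / p = 0 := by
    rw [pow_zero, inv_one, Units.val_one, ZMod.val_one, mul_one, Nat.div_eq_of_lt (ZMod.val_lt _)]
  rw [h0, Nat.cast_zero, mul_zero, zero_add, ← Finset.sum_neg_distrib]
  refine Finset.sum_congr rfl fun i _ => ?_
  rw [delta_natCast, Int.cast_neg, Int.cast_natCast]
  ring

theorem PClassGroup.eval_Q (v : (ZMod p)ˣ) (x : ℤ) :
    (((Q v).eval x : ℤ) : ZMod p) =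
      ∑ i ∈ Finset.Icc 1 (p - 2), ((delta v (i : ℤ) : ℤ) : ZMod p) * (x : ZMod p) ^ i := by
  rw [Q, Polynomial.eval_finsetSum]
  simp

/-- For 0 < a < p, ⌊(p - 1) a / p⌋ = a - 1, so each term is 1 - v^i; the geometric sum vanishes and
p - 1 = -1 remains. -/
theorem ZMod.sum_pow_mul_sub_one_mul_inv_val_div_ne_zero (hp2 : p ≠ 2) {v : (ZMod p)ˣ}
    (hv : orderOf v = p - 1) :
    ∑ i ∈ Finset.range (p - 1), (v : ZMod p) ^ i *
      (((p - 1) * (((v ^ i)⁻¹ : (ZMod p)ˣ) : ZMod p).val / p : ℕ) : ZMod p) ≠ 0 := by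
  have hp2' := hp.out.two_le
  have h1 : ∀ i ∈ Finset.range (p - 1), (v : ZMod p) ^ i *
      (((p - 1) * (((v ^ i)⁻¹ : (ZMod p)ˣ) : ZMod p).val / p : ℕ) : ZMod p) =
      1 - (v : ZMod p) ^ i := by
    intro i _
    obtain ⟨a, ha⟩ : ∃ a, a = (((v ^ i)⁻¹ : (ZMod p)ˣ) : ZMod p).val := ⟨_, rfl⟩
    have ha0 : 0 < a := ha ▸ ZMod.val_pos.2 (Units.ne_zero _)
    have hap : a < p := ha ▸ ZMod.val_lt _
    have h2 : (p - 1) * a / p = a - 1 := by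
      obtain ⟨q, rfl⟩ : ∃ q, p = q + 1 := ⟨p - 1, by omega⟩
      obtain ⟨b, rfl⟩ : ∃ b, a = b + 1 := ⟨a - 1, by omega⟩
      rw [Nat.add_sub_cancel, Nat.add_sub_cancel,
        show q * (b + 1) = (q + 1) * b + (q - b) by
          have : b ≤ q := by omega
          zify [this]; ring,
        Nat.mul_add_div (by omega), Nat.div_eq_of_lt (by omega), add_zero]
    rw [← ha, h2, Nat.cast_sub ha0, ha, ZMod.natCast_zmod_val, mul_sub, Nat.cast_one, mul_one,
      ← Units.val_pow_eq_pow_val, Units.mul_inv]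
  rw [Finset.sum_congr rfl h1, Finset.sum_sub_distrib]
  have hgeom : ∑ i ∈ Finset.range (p - 1), (v : ZMod p) ^ i = 0 := by
    have h3 := geom_sum_mul (v : ZMod p) (p - 1)
    rw [ZMod.pow_card_sub_one_eq_one (Units.ne_zero v), sub_self] at h3
    refine (mul_eq_zero.1 h3).resolve_right fun h4 => ?_
    have h5 : v = 1 := by ext; simpa using sub_eq_zero.1 h4
    rw [h5, orderOf_one] at hv
    omega
  rw [hgeom, sub_zero, Finset.sum_const, Finset.card_range, nsmul_one,
    Nat.cast_sub (by omega), CharP.cast_eq_zero, Nat.cast_one, zero_sub]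
  exact neg_ne_zero.2 one_ne_zero

end Delta

/-! ### Complex conjugation on the p-torsion -/

section Norm

open PClassGroup

variable {K : Type*} [Field K] [NumberField K] [IsCMField K]

/-- The product of I with its conjugate is extended from the norm of I. The p-th power of that norm
is principal, hence so is the norm itself, since p is prime to h⁺. -/
theorem PClassGroup.mul_classAct_complexConj_eq_one {p : ℕ} (hp : p.Prime)
    (hplus : ¬ p ∣ NumberField.classNumber (maximalRealSubfield K)) {c : ClassGroup (𝓞 K)}
    (hc : c ^ p = 1) :
    c * classAct ((IsCMField.complexConj K).restrictScalars ℚ) c = 1 := by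
  classical
  obtain ⟨I, hI, rfl⟩ := ClassGroup.exists_mk0_eq c
  have huniv : (Finset.univ : Finset (K ≃ₐ[maximalRealSubfield K] K)) =
      {1, IsCMField.complexConj K} := by
    ext g
    have hg : g ∈ Subgroup.zpowers (IsCMField.complexConj K) := by
      rw [IsCMField.zpowers_complexConj_eq_top]; exact Subgroup.mem_top g
    rw [← mem_powers_iff_mem_zpowers, mem_powers_iff_mem_range_orderOf,
      IsCMField.orderOf_complexConj] at hg
    simpa [Finset.range_add_one, eq_comm, or_comm] using hg
  have hnorm := Ideal.map_relNorm_eq_prod_smul (R := 𝓞 (maximalRealSubfield K)) (S := 𝓞 K)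
    (G := K ≃ₐ[maximalRealSubfield K] K)
    (fun q hq _ => NumberField.perfectField_residueField q hq) I
  rw [huniv, Finset.prod_pair (IsCMField.complexConj_ne_one K).symm, one_smul] at hnorm
  rw [← map_pow, SubmonoidClass.mk_pow, ClassGroup.mk0_eq_one_iff] at hc
  have hprin : (Ideal.relNorm (𝓞 (maximalRealSubfield K)) I).IsPrincipal := by
    refine Ideal.IsPrincipal.of_isPrincipal_pow_of_coprime ((hp.coprime_iff_not_dvd).2 hplus) ?_
    obtain ⟨x, hx⟩ := hc
    rw [← map_pow, hx]
    exact ⟨_, Ideal.relNorm_singleton _ x⟩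
  rw [classAct_mk0 _ hI, ← map_mul, ClassGroup.mk0_eq_one_iff]
  change (I * (IsCMField.complexConj K) • I).IsPrincipal
  rw [← hnorm]
  obtain ⟨x, hx⟩ := hprin
  refine ⟨algebraMap _ _ x, ?_⟩
  rw [hx]
  simp [Ideal.submodule_span_eq, Ideal.map_span]

end Norm

end

/-! ### Diagonalization over 𝔽_p -/

section Eigenvectors

variable {p : ℕ} [hp : Fact p.Prime]

theorem Module.End.span_eigenvectors_eq_top_of_pow_sub_one_eq_one {V : Type*} [AddCommGroup V]
    [Module (ZMod p) V] {T : Module.End (ZMod p) V} (hT : T ^ (p - 1) = 1) :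
    Submodule.span (ZMod p) {x | ∃ u : (ZMod p)ˣ, T x = (u : ZMod p) • x} = ⊤ := by
  have hp1 : 0 < p - 1 := Nat.sub_pos_of_lt hp.out.one_lt
  rw [eq_top_iff]
  intro x _
  -- Up to the factor -1 = p - 1, `y u` is the projection of `x` to the `u`-eigenspace.
  let y : (ZMod p)ˣ → V := fun u =>
    ∑ i ∈ Finset.range (p - 1), ((u⁻¹ : (ZMod p)ˣ) : ZMod p) ^ i • (T ^ i) x
  have hy : ∀ u, T (y u) = (u : ZMod p) • y u := by
    intro u
    have h1 : ∀ i, T (((u⁻¹ : (ZMod p)ˣ) : ZMod p) ^ i • (T ^ i) x) =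
        (u : ZMod p) • (((u⁻¹ : (ZMod p)ˣ) : ZMod p) ^ (i + 1) • (T ^ (i + 1)) x) := by
      intro i
      rw [map_smul, smul_smul, pow_succ', ← mul_assoc, Units.mul_inv, one_mul, pow_succ',
        Module.End.mul_apply]
    simp only [y, map_sum, Finset.smul_sum, h1]
    rw [← Finset.smul_sum, ← Finset.smul_sum]
    congr 1
    have h2 := Finset.sum_range_succ (fun i => ((u⁻¹ : (ZMod p)ˣ) : ZMod p) ^ i • (T ^ i) x) (p - 1)
    rw [Finset.sum_range_succ', hT, ZMod.pow_card_sub_one_eq_one (Units.ne_zero _), pow_zero,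
      pow_zero] at h2
    exact add_right_cancel h2
  have hsum : ∑ u, y u = -x := by
    simp only [y]
    rw [Finset.sum_comm]
    have h3 : ∀ i ∈ Finset.range (p - 1),
        ∑ u : (ZMod p)ˣ, ((u⁻¹ : (ZMod p)ˣ) : ZMod p) ^ i • (T ^ i) x =
          if i = 0 then -x else 0 := by
      intro i hi
      rw [Finset.mem_range] at hi
      have hinv : ∑ u : (ZMod p)ˣ, ((u⁻¹ : (ZMod p)ˣ) : ZMod p) ^ i =
          ∑ u : (ZMod p)ˣ, (u : ZMod p) ^ i :=
        Equiv.sum_comp (Equiv.inv (ZMod p)ˣ) fun u : (ZMod p)ˣ => (u : ZMod p) ^ i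
      rw [← Finset.sum_smul, hinv, FiniteField.sum_pow_units, ZMod.card]
      split_ifs with h4 h5 h5
      · rw [h5, pow_zero, neg_one_smul, Module.End.one_apply]
      · exact absurd (Nat.le_of_dvd (Nat.pos_of_ne_zero h5) h4) (by omega)
      · exact absurd (h5 ▸ dvd_zero _) h4
      · rw [zero_smul]
    rw [Finset.sum_congr rfl h3, Finset.sum_ite_eq' (Finset.range (p - 1)) 0 (fun _ => -x),
      if_pos (Finset.mem_range.2 hp1)]
  rw [← neg_neg x, ← hsum]
  exact neg_mem (sum_mem fun u _ => Submodule.subset_span ⟨u, hy u⟩)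

theorem Module.End.exists_basis_eigenvectors_of_pow_sub_one_eq_one {V : Type*} [AddCommGroup V]
    [Module (ZMod p) V] [Finite V] {T : Module.End (ZMod p) V} (hT : T ^ (p - 1) = 1) :
    ∃ (r : ℕ) (b : Fin r → V) (μ : Fin r → (ZMod p)ˣ), LinearIndependent (ZMod p) b ∧
      Submodule.span (ZMod p) (Set.range b) = ⊤ ∧ ∀ k, T (b k) = (μ k : ZMod p) • b k := by
  obtain ⟨B, hB, hspan, hli⟩ := exists_linearIndependent (ZMod p)
    {x : V | ∃ u : (ZMod p)ˣ, T x = (u : ZMod p) • x}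
  rw [span_eigenvectors_eq_top_of_pow_sub_one_eq_one hT] at hspan
  obtain ⟨r, ⟨e⟩⟩ := Finite.exists_equiv_fin B
  choose μ hμ using fun k => hB (e.symm k).2
  refine ⟨r, fun k => (e.symm k : V), μ, hli.comp _ e.symm.injective, ?_, hμ⟩
  rw [← hspan]
  congr 1
  ext x
  constructor
  · rintro ⟨k, rfl⟩
    exact (e.symm k).2
  · intro hx
    exact ⟨e ⟨x, hx⟩, by simp⟩

theorem AddMonoidHom.exists_diagonalization {V : Type*} [AddCommGroup V]
    [Finite V] [Module (ZMod p) V] (T : V →+ V) (hT : ∀ x, T^[p - 1] x = x) :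
    ∃ (r : ℕ) (Γ : Fin r → AddSubgroup V) (μ : Fin r → (ZMod p)ˣ),
      (∀ k, Nat.card (Γ k) = p) ∧ (∀ k, ∀ c ∈ Γ k, T c = ((μ k : ZMod p).val) • c) ∧
      iSupIndep Γ ∧ ⨆ k, Γ k = ⊤ := by
  let TV : Module.End (ZMod p) V := T.toZModLinearMap p
  have hone : TV ^ (p - 1) = 1 := by
    ext x
    rw [Module.End.pow_apply]
    exact hT x
  obtain ⟨r, b, μ, hli, hspan, hμ⟩ :=
    Module.End.exists_basis_eigenvectors_of_pow_sub_one_eq_one hone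
  let Δ : Submodule (ZMod p) V ≃o AddSubgroup V := (AddSubgroup.toZModSubmodule p (M := V)).symm
  refine ⟨r, fun k => Δ (Submodule.span (ZMod p) {b k}), μ, fun k => ?_, fun k c hc => ?_,
    hli.iSupIndep_span_singleton.map_orderIso Δ, ?_⟩
  · have h1 : Nat.card (Δ (Submodule.span (ZMod p) {b k})) =
        Nat.card (Submodule.span (ZMod p) {b k}) := rfl
    rw [h1, Nat.card_congr (LinearEquiv.toSpanNonzeroSingleton (ZMod p) V (b k)
      (hli.ne_zero k)).symm.toEquiv, Nat.card_zmod]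
  · obtain ⟨a, rfl⟩ := Submodule.mem_span_singleton.1
      (show c ∈ Submodule.span (ZMod p) {b k} from hc)
    rw [← Nat.cast_smul_eq_nsmul (ZMod p), ZMod.natCast_zmod_val, smul_comm, ← hμ k]
    exact map_smul TV a (b k)
  · rw [← Δ.map_iSup, ← Submodule.span_range_eq_iSup, hspan, Δ.map_top]

end Eigenvectors

section Decomposition

open PClassGroup

variable {p : ℕ} [hp : Fact p.Prime]

theorem Subgroup.iSupIndep_map {ι G H : Type*} [Group G] [Group H] {f : G →* H}
    (hf : Function.Injective f) {A : ι → Subgroup G} (hA : iSupIndep A) :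
    iSupIndep fun i => (A i).map f := by
  intro i
  have := Subgroup.disjoint_map hf (hA i)
  simpa only [Subgroup.map_iSup] using this

/-- A group automorphism of order dividing `p - 1` acts diagonalizably on the `p`-torsion of a
finite abelian group. -/
theorem MulEquiv.exists_diagonalization {G : Type*} [CommGroup G] [Finite G] (T : G ≃* G)
    (hT : ∀ x, T^[p - 1] x = x) :
    ∃ (r : ℕ) (Γ : Fin r → Subgroup G) (μ : Fin r → (ZMod p)ˣ),
      (∀ k, Nat.card (Γ k) = p) ∧ (∀ k, ∀ c ∈ Γ k, T c = c ^ ((μ k : ZMod p).val)) ∧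
      iSupIndep Γ ∧ ⨆ k, Γ k = (powMonoidHom p : G →* G).ker := by
  classical
  let W : Subgroup G := (powMonoidHom p : G →* G).ker
  have hker : ∀ x : W, (x : G) ^ p = 1 := fun x => x.2
  have hV : ∀ x : Additive W, p • x = 0 := by
    intro x
    apply Additive.toMul.injective
    ext
    exact hker (Additive.toMul x)
  have hTW : ∀ x : W, T x ∈ W := by
    intro x
    change (T x) ^ p = 1
    rw [← map_pow, hker, map_one]
  let TW : W →* W := (T.toMonoidHom.comp W.subtype).codRestrict W hTW
  have hTWpow : ∀ (n : ℕ) (x : W), ((TW^[n] x : W) : G) = T^[n] (x : G) := by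
    intro n
    induction n with
    | zero => intro x; rfl
    | succ n ih => intro x; rw [Function.iterate_succ_apply, ih, Function.iterate_succ_apply]; rfl
  have hVfin : Finite (Additive W) := inferInstanceAs (Finite W)
  obtain ⟨r, Γ, μ, hcard, hΓ, hind, hsup⟩ :=
    @AddMonoidHom.exists_diagonalization p hp (Additive W) _ _ (AddCommGroup.zmodModule hV)
      (MonoidHom.toAdditive TW)
      (fun x => Subtype.ext ((hTWpow (p - 1) x.toMul).trans (hT _)))
  let Δ : AddSubgroup (Additive W) ≃o Subgroup W := (Subgroup.toAddSubgroup (G := W)).symm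
  refine ⟨r, fun k => (Δ (Γ k)).map W.subtype, μ, fun k => ?_, fun k c hc => ?_,
    Subgroup.iSupIndep_map W.subtype_injective (hind.map_orderIso Δ), ?_⟩
  · rw [Nat.card_congr (Subgroup.equivMapOfInjective _ _ W.subtype_injective).symm.toEquiv]
    exact hcard k
  · obtain ⟨w, hw, rfl⟩ := hc
    exact congrArg (fun x : Additive W => ((x.toMul : W) : G)) (hΓ k (Additive.ofMul w) hw)
  · rw [← Subgroup.map_iSup, ← Δ.map_iSup, hsup, Δ.map_top, ← MonoidHom.range_eq_map,
      Subgroup.range_subtype]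

end Decomposition

/-! ### Divisibility in the group ring -/

section GroupRing

open Polynomial

variable {p : ℕ} [hp : Fact p.Prime]

/-- If `x ^ (p - 1) = 1` in an algebra over `𝔽_p`, divisibility of polynomials in `x` is detected
by the roots in `𝔽_p`. -/
theorem Polynomial.aeval_dvd_aeval_of_roots {A : Type*} [Ring A] [Algebra (ZMod p) A] {x : A}
    (hx : x ^ (p - 1) = 1) {f g : (ZMod p)[X]} (h : ∀ u, f.eval u = 0 → g.eval u = 0) :
    aeval x f ∣ aeval x g := by
  classical
  have hp1 : 0 < p - 1 := Nat.sub_pos_of_lt hp.out.one_lt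
  let S : (ZMod p)[X] := X ^ (p - 1) - 1
  have hS0 : S ≠ 0 := (monic_X_pow_sub_C (1 : ZMod p) hp1.ne').ne_zero
  have hD0 : EuclideanDomain.gcd f S ≠ 0 := fun h0 => hS0 (EuclideanDomain.gcd_eq_zero_iff.1 h0).2
  -- Multiplying by `X` gives X^p - X, whose roots are all of 𝔽_p, each simple; divisors of it are
  -- determined by their roots.
  have hSX : X * S = X ^ Fintype.card (ZMod p) - X := by
    rw [ZMod.card, mul_sub, mul_one, ← pow_succ', Nat.sub_add_cancel hp.out.one_le]
  have hXS0 : X * S ≠ 0 := mul_ne_zero X_ne_zero hS0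
  have hsplit : (X * S).Splits := by
    rw [splits_iff_card_roots, hSX, FiniteField.roots_X_pow_card_sub_X,
      FiniteField.X_pow_card_sub_X_natDegree_eq _ Fintype.one_lt_card]
    rfl
  have hnodup : (X * S).roots.Nodup := by
    rw [hSX, FiniteField.roots_X_pow_card_sub_X]
    exact Finset.univ.nodup
  have hDdvd : EuclideanDomain.gcd f S ∣ X * S :=
    (EuclideanDomain.gcd_dvd_right f S).mul_left X
  have hDg : EuclideanDomain.gcd f S ∣ g := by
    by_cases hg : g = 0
    · rw [hg]; exact dvd_zero _
    refine (hsplit.of_dvd hXS0 hDdvd).dvd_of_roots_le_roots hD0 ?_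
    rw [Multiset.le_iff_subset (Multiset.nodup_of_le (roots.le_of_dvd hXS0 hDdvd) hnodup)]
    intro u hu
    rw [mem_roots hD0] at hu
    rw [mem_roots hg]
    exact h u (hu.dvd (EuclideanDomain.gcd_dvd_left f S))
  obtain ⟨q, hq⟩ := hDg
  have hS : aeval x S = 0 := by simp [S, hx]
  -- By Bézout, the gcd evaluated at `x` is a multiple of `aeval x f`, since `S` vanishes at `x`.
  rw [hq, EuclideanDomain.gcd_eq_gcd_ab, map_mul, map_add, map_mul, map_mul, hS, zero_mul,
    add_zero, mul_assoc]
  exact dvd_mul_right _ _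

end GroupRing

/-! ### Which eigenvalues occur -/

section Odd

open PClassGroup IsCyclotomicExtension.Rat

variable {p : ℕ} [hp : Fact p.Prime] {K : Type*} [Field K] [NumberField K]
  [IsCyclotomicExtension {p} ℚ K]

theorem IsCyclotomicExtension.Rat.orderOf_eq_of_galEquivZMod_eq {σ : K ≃ₐ[ℚ] K} {v : (ZMod p)ˣ}
    (hv : orderOf v = p - 1) (hσ : galEquivZMod p K σ = v) : orderOf σ = p - 1 := by
  rw [← hv, ← hσ]
  exact ((galEquivZMod p K).orderOf_eq σ).symm

/-- A cyclic group of even order has a single involution. -/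
theorem IsCyclotomicExtension.Rat.complexConj_eq_pow [IsCMField K] (hp2 : p ≠ 2)
    {σ : K ≃ₐ[ℚ] K} {v : (ZMod p)ˣ} (hv : orderOf v = p - 1) (hσ : galEquivZMod p K σ = v) :
    (IsCMField.complexConj K).restrictScalars ℚ = σ ^ ((p - 1) / 2) := by
  have ho := orderOf_eq_of_galEquivZMod_eq hv hσ
  have hp1 : p - 1 = 2 * ((p - 1) / 2) := by
    have := hp.out.eq_two_or_odd
    omega
  have hpos : 0 < (p - 1) / 2 := by
    have := hp.out.two_le
    omega
  obtain ⟨J, hJ⟩ : ∃ J, J = (IsCMField.complexConj K).restrictScalars ℚ := ⟨_, rfl⟩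
  have hJ1 : J ≠ 1 := by
    intro h
    apply IsCMField.complexConj_ne_one K
    ext x
    exact DFunLike.congr_fun (hJ.symm.trans h) x
  have hJ2 : J ^ 2 = 1 := by
    ext x
    rw [hJ, pow_two]
    exact IsCMField.complexConj_apply_apply K x
  rw [← hJ]
  obtain ⟨n, hn⟩ := mem_powers_iff_mem_zpowers.2 (mem_zpowers_of_orderOf hv hσ J)
  simp only at hn
  rw [← hn, ← pow_mul, ← orderOf_dvd_iff_pow_eq_one, ho] at hJ2
  have h1 : (p - 1) / 2 ∣ n := by
    rw [hp1, mul_comm n 2] at hJ2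
    exact Nat.dvd_of_mul_dvd_mul_left two_pos hJ2
  obtain ⟨q, rfl⟩ := h1
  have hσ2 : (σ ^ ((p - 1) / 2)) ^ 2 = 1 := by
    rw [← pow_mul, mul_comm, ← hp1, ← ho, pow_orderOf_eq_one]
  rw [pow_mul] at hn
  rcases Nat.even_or_odd' q with ⟨s, rfl | rfl⟩
  · rw [pow_mul, hσ2, one_pow] at hn
    exact absurd hn.symm hJ1
  · rw [pow_succ, pow_mul, hσ2, one_pow, one_mul] at hn
    exact hn.symm

/-- If `p` does not divide the class number of the maximal real subfield, then the eigenvalues of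
`σ` on classes of order `p` are odd powers of `v` other than `v` itself. -/
theorem PClassGroup.exists_eq_pow_odd (hp2 : p ≠ 2)
    (hplus : ¬ p ∣ NumberField.classNumber (maximalRealSubfield K)) {σ : K ≃ₐ[ℚ] K}
    {v : (ZMod p)ˣ} (hv : orderOf v = p - 1) (hσ : galEquivZMod p K σ = v)
    {c : ClassGroup (𝓞 K)} (hc : orderOf c = p) {μ : (ZMod p)ˣ}
    (hμ : classAct σ c = c ^ ((μ : ZMod p).val)) :
    ∃ m : ℕ, 1 ≤ m ∧ m ≤ (p - 3) / 2 ∧ μ = v ^ (2 * m + 1) := by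
  have hp3 : 2 < p := lt_of_le_of_ne hp.out.two_le (Ne.symm hp2)
  have : IsCMField K := IsCyclotomicExtension.Rat.isCMField K (S := {p}) ⟨p, rfl, hp3⟩
  have hpodd : p - 1 = 2 * ((p - 1) / 2) := by
    have := hp.out.eq_two_or_odd
    omega
  have hcp : c ^ p = 1 := by rw [← hc, pow_orderOf_eq_one]
  have hmem : μ ∈ Subgroup.zpowers v := by
    have h1 : Subgroup.zpowers v = ⊤ := by
      rw [← Subgroup.card_eq_iff_eq_top, Nat.card_zpowers, hv, Nat.card_eq_fintype_card,
        ZMod.card_units]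
    rw [h1]
    exact Subgroup.mem_top μ
  rw [← mem_powers_iff_mem_zpowers, mem_powers_iff_mem_range_orderOf, hv, Finset.mem_image] at hmem
  obtain ⟨j, hj, rfl⟩ := hmem
  rw [Finset.mem_range] at hj
  rcases Nat.even_or_odd' j with ⟨m, rfl | rfl⟩
  -- For an even power of `v`, complex conjugation σ^((p-1)/2) fixes `c` but also inverts it, so `c
  -- ^ 2 = 1`, impossible for odd p.
  · exfalso
    have h1 : (v ^ (2 * m)) ^ ((p - 1) / 2) = 1 := by
      rw [← pow_mul, show 2 * m * ((p - 1) / 2) = (2 * ((p - 1) / 2)) * m by ring, ← hpodd, ← hv,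
        pow_mul, pow_orderOf_eq_one, one_pow]
    have h2 : c ^ (((v ^ (2 * m) : (ZMod p)ˣ) : ZMod p).val ^ ((p - 1) / 2)) = c ^ 1 := by
      rw [pow_eq_pow_iff_modEq, hc, ← ZMod.natCast_eq_natCast_iff, Nat.cast_pow,
        ZMod.natCast_zmod_val, ← Units.val_pow_eq_pow_val, h1]
      simp
    have h3 := mul_classAct_complexConj_eq_one hp.out hplus hcp
    rw [complexConj_eq_pow hp2 hv hσ, classAct_pow_of_eq_pow hμ, h2, pow_one, ← pow_two,
      ← orderOf_dvd_iff_pow_eq_one, hc] at h3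
    exact absurd (Nat.le_of_dvd two_pos h3) (not_le.2 hp3)
  · refine ⟨m, ?_, by omega, rfl⟩
    by_contra h0
    obtain rfl : m = 0 := by omega
    rw [mul_zero, zero_add, pow_one] at hμ
    exact ZMod.sum_pow_mul_sub_one_mul_inv_val_div_ne_zero hp2 hv
      (sum_pow_mul_div_eq_zero hv hσ hc hμ (b := p - 1) (by omega) (by omega))

end Odd

/-! ### Assembly of the main theorem -/

theorem theoremt512171
    (p : ℕ) [Fact p.Prime] (hp : p ≠ 2)
    (K : Type*) [Field K] [NumberField K] [IsCyclotomicExtension {p} ℚ K]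
    (v : (ZMod p)ˣ) (hv : orderOf v = p - 1)
    (ζ : K) (hζ : IsPrimitiveRoot ζ p)
    (σ : K ≃ₐ[ℚ] K) (hσ : σ ζ = ζ ^ ((v : ZMod p).val))
    (hplus : ¬ p ∣ NumberField.classNumber (NumberField.maximalRealSubfield K)) :
    (∃ (r : ℕ) (Γ : Fin r → Subgroup (ClassGroup (NumberField.RingOfIntegers K)))
        (μ : Fin r → (ZMod p)ˣ), PClassGroup.IsDecomposition p σ Γ μ) ∧
    ∀ (r : ℕ) (Γ : Fin r → Subgroup (ClassGroup (NumberField.RingOfIntegers K)))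
      (μ : Fin r → (ZMod p)ˣ), PClassGroup.IsDecomposition p σ Γ μ →
      ∃ m : Fin r → ℕ,
        (∀ k, 1 ≤ m k ∧ m k ≤ (p - 3) / 2 ∧ μ k = v ^ (2 * m k + 1)) ∧
        (∀ k, (PClassGroup.Q v).eval (PClassGroup.res v (2 * m k + 1)) ≡ 0 [ZMOD p] ∧
          ∑ i ∈ Finset.Icc 1 (p - 2),
            PClassGroup.res v ((2 * m k + 1) * i) * PClassGroup.delta v i ≡ 0 [ZMOD p]) ∧
        Polynomial.aeval (MonoidAlgebra.of (ZMod p) (K ≃ₐ[ℚ] K) σ)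
            (∏ k, (Polynomial.X - Polynomial.C ((v : ZMod p) ^ (2 * m k + 1)))) ∣
          Polynomial.aeval (MonoidAlgebra.of (ZMod p) (K ≃ₐ[ℚ] K) σ) (PClassGroup.Q v) := by
  classical
  have hσv := IsCyclotomicExtension.Rat.galEquivZMod_eq_of_apply hζ hσ
  have hord := IsCyclotomicExtension.Rat.orderOf_eq_of_galEquivZMod_eq hv hσv
  have hσ1 : σ ^ (p - 1) = 1 := by rw [← hord, pow_orderOf_eq_one]
  refine ⟨?_, fun r Γ μ hdec => ?_⟩
  · obtain ⟨r, Γ, μ, h1, h2, h3, h4⟩ :=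
      MulEquiv.exists_diagonalization (p := p) (PClassGroup.classAct σ) (fun x => by
        rw [← PClassGroup.classAct_pow, hσ1, PClassGroup.classAct_one])
    exact ⟨r, Γ, μ, h1, h2, h3, h4⟩
  have hgen : ∀ k, ∃ c : ClassGroup (𝓞 K), orderOf c = p ∧
      PClassGroup.classAct σ c = c ^ ((μ k : ZMod p).val) := by
    intro k
    have hcard := hdec.card_eq k
    have : Nontrivial (Γ k) := by
      rw [← Finite.one_lt_card_iff_nontrivial, hcard]
      exact (Fact.out : p.Prime).one_lt
    obtain ⟨c, hc⟩ := exists_ne (1 : Γ k)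
    refine ⟨c, ?_, hdec.annihilated k c c.2⟩
    rw [Subgroup.orderOf_coe]
    refine orderOf_eq_prime ?_ hc
    rw [← hcard, pow_card_eq_one']
  have hodd : ∀ k, ∃ m : ℕ, 1 ≤ m ∧ m ≤ (p - 3) / 2 ∧ μ k = v ^ (2 * m + 1) := by
    intro k
    obtain ⟨c, hc, hcμ⟩ := hgen k
    exact PClassGroup.exists_eq_pow_odd hp hplus hv hσv hc hcμ
  choose m hm using hodd
  have hsum : ∀ k, ∑ i ∈ Finset.Icc 1 (p - 2),
      ((PClassGroup.delta v (i : ℤ) : ℤ) : ZMod p) * (μ k : ZMod p) ^ i = 0 := by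
    intro k
    obtain ⟨c, hc, hcμ⟩ := hgen k
    -- The Stickelberger relation is taken at b = v, the representative in {1, …, p - 1}.
    rw [PClassGroup.sum_delta_mul_pow, PClassGroup.sum_pow_mul_div_eq_zero hv hσv hc hcμ
      (Nat.one_le_iff_ne_zero.2 (ZMod.val_pos.2 (Units.ne_zero v)).ne') (ZMod.val_lt _), neg_zero]
  have hpow : ∀ k, (((v ^ (2 * (m k : ℤ) + 1) : (ZMod p)ˣ)) : ZMod p) = (μ k : ZMod p) := by
    intro k
    rw [(hm k).2.2]
    norm_cast
  refine ⟨m, hm, fun k => ⟨?_, ?_⟩, ?_⟩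
  · rw [← ZMod.intCast_eq_intCast_iff, PClassGroup.eval_Q, PClassGroup.cast_res, hpow, hsum,
      Int.cast_zero]
  · rw [← ZMod.intCast_eq_intCast_iff, Int.cast_sum, Int.cast_zero, ← hsum k]
    refine Finset.sum_congr rfl fun i _ => ?_
    rw [Int.cast_mul, PClassGroup.cast_res, zpow_mul, zpow_natCast, Units.val_pow_eq_pow_val, hpow,
      mul_comm]
  · obtain ⟨x, hx⟩ : ∃ x, x = MonoidAlgebra.of (ZMod p) (K ≃ₐ[ℚ] K) σ := ⟨_, rfl⟩
    have hx1 : x ^ (p - 1) = 1 := by rw [hx, ← map_pow, hσ1, map_one]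
    rw [← hx, ← Polynomial.aeval_map_algebraMap (ZMod p) x (PClassGroup.Q v)]
    -- The `μ k` may repeat, but multiplicities are irrelevant: it suffices that `Q` vanishes at
    -- each of them.
    refine Polynomial.aeval_dvd_aeval_of_roots hx1 fun u hu => ?_
    rw [Polynomial.eval_prod, Finset.prod_eq_zero_iff] at hu
    obtain ⟨k, _, hk⟩ := hu
    obtain ⟨y, hy⟩ : ∃ y : ℤ, (y : ZMod p) = μ k := ⟨_, ZMod.intCast_zmod_cast _⟩
    have hu' : u = (y : ZMod p) := by
      rw [Polynomial.eval_sub, Polynomial.eval_X, Polynomial.eval_C, sub_eq_zero] at hk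
      rw [hk, hy, (hm k).2.2, Units.val_pow_eq_pow_val]
    rw [hu', algebraMap_int_eq, Polynomial.eval_intCast_map, eq_intCast, Int.cast_id,
      PClassGroup.eval_Q, hy, hsum]
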